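/- Let $k$ be an algebraically closed field and let $G$ be a finite abelian group whose order is not divisible by the characteristic of $k$. A variety is an integral separated scheme of finite type over $k$. Let $Y$ be a smooth variety. A (normal) $G$-cover of $Y$ is a finite morphism $\pi\colon X\to Y$ with $X$ a normal variety, together with a faithful action of $G$ on $X$ commuting with $\pi$ such that $Y=X/G$ via $\pi$. For such a cover: * For a character $\chi\in G^*=\operatorname{Hom}(G,k^*)$ let $L_\chi^{-1}\subset\pi_*\mathcal O_X$ be the $\mathcal O_Y$-submodule of the sections $f$ with $g^*f=\chi(g)f$ for all $g\in G$, so that $\pi_*\mathcal O_X=\bigoplus_{\chi\in G^*}L_\chi^{-1}$. These are line bundles, with inverses $L_\chi$. * Let $R\subset X$ be the locus of points with non-trivial stabilizer and let $D=\pi(R)$, both with the reduced structure. An irreducible component $T$ of $R$ has an inertia group $H=\{h\in G: hx=x\ \forall x\in T\}$ and an associated character $\psi\colon H\to k^*$, through which $H$ acts on the conormal space of $T$ in $X$ at the generic point of $T$ (functions being acted on by pull-back). All components of $R$ lying over the same irreducible component $E$ of $D$ have the same $(H,\psi)$, which is called the pair associated to $E$. For a subgroup $H\subset G$ and a character $\psi$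 of $H$, let $D_{H,\psi}$ be the union of the irreducible components of $D$ whose associated pair is $(H,\psi)$. The $L_\chi$ and the $D_{H,\psi}$ are the building data of the cover. Two $G$-covers of $Y$, with building data $L_\chi, D_{H,\psi}$ and $L'_\chi, D'_{H,\psi}$, have the same building data if $L_\chi\cong L'_\chi$ for every $\chi\in G^*$ and $D_{H,\psi}=D'_{H,\psi}$ for all $(H,\psi)$. **Proposition.** Let $\pi\colon X\to Y$ and $\pi'\colon X'\to Y$ be $G$-covers of the smooth variety $Y$, with $X$ and $X'$ normal varieties, having the same building data. Then for each point $y\in Y$ there exist an étale morphism $f\colon U\to Y$ whose image contains $y$ and a $G$-equivariant isomorphism $X\times_Y U\cong X'\times_Y U$ over $U$. -/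

import Mathlib

open CategoryTheory AlgebraicGeometry

universe u v

namespace AbelianCover

noncomputable section

/-- A variety over the field `k`, given by its structure morphism: an integral separated scheme
of finite type over `k`. -/
structure IsVariety {k : Type u} [Field k] {X : Scheme.{u}} (s : X ⟶ Spec (.of k)) : Prop where
  isIntegral : IsIntegral X
  isSeparated : IsSeparated s
  locallyOfFiniteType : LocallyOfFiniteType s
  quasiCompact : QuasiCompact s

/-- A normal scheme: all local rings are integrally closed domains. -/
def IsNormalScheme (X : Scheme.{u}) : Prop :=
  ∀ x : X, IsDomain (X.presheaf.stalk x) ∧ IsIntegrallyClosed (X.presheaf.stalk x)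

/-- The constants `k → Γ(X, U)` of a `k`-scheme. -/
def scalar {k : Type u} [Field k] {X : Scheme.{u}} (s : X ⟶ Spec (.of k)) (U : X.Opens) :
    k →+* Γ(X, U) :=
  ((Scheme.ΓSpecIso (.of k)).inv ≫ s.appLE ⊤ U le_top).hom

theorem res_scalar {k : Type u} [Field k] {X : Scheme.{u}} (s : X ⟶ Spec (.of k))
    {U V : X.Opens} (h : U ≤ V) (c : k) :
    (X.presheaf.map (homOfLE h).op).hom (scalar s V c) = scalar s U c := by
  have := s.appLE_map (U := ⊤) (V := V) (V' := U) le_top (homOfLE h).op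
  simp only [scalar]
  rw [← this]
  rfl

section Action

variable {G : Type v} [CommGroup G] {X Y : Scheme.{u}} {π : X ⟶ Y}

/-- An action of `G` on `X` commuting with `π` is a homomorphism `ρ` from `G` to the group of
automorphisms of `X` over `Y`; this is the automorphism of `X` by which `g` acts. -/
def act (ρ : G →* Aut (Over.mk π)) (g : G) : X ⟶ X := (ρ g).hom.left

theorem act_comp (ρ : G →* Aut (Over.mk π)) (g : G) : act ρ g ≫ π = π :=
  Over.w (ρ g).hom

theorem act_one (ρ : G →* Aut (Over.mk π)) : act ρ 1 = 𝟙 X := by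
  simp only [act, map_one]; rfl

theorem act_mul (ρ : G →* Aut (Over.mk π)) (g h : G) : act ρ (g * h) = act ρ h ≫ act ρ g := by
  simp only [act, map_mul]; rfl

theorem preimage_le (ρ : G →* Aut (Over.mk π)) (g : G) (U : Y.Opens) :
    π ⁻¹ᵁ U ≤ act ρ g ⁻¹ᵁ π ⁻¹ᵁ U := by
  rw [← Scheme.Hom.comp_preimage, act_comp]

/-- The action of `g` on `Γ(U, π_* 𝒪_X) = Γ(π⁻¹ U, 𝒪_X)`: pull-back of functions along `g`. -/
def pull (ρ : G →* Aut (Over.mk π)) (g : G) (U : Y.Opens) : Γ(X, π ⁻¹ᵁ U) →+* Γ(X, π ⁻¹ᵁ U) :=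
  ((act ρ g).appLE (π ⁻¹ᵁ U) (π ⁻¹ᵁ U) (preimage_le ρ g U)).hom

/-- The restriction maps of the sheaf `π_* 𝒪_X`. -/
def res (π : X ⟶ Y) {U V : Y.Opens} (h : U ≤ V) : Γ(X, π ⁻¹ᵁ V) →+* Γ(X, π ⁻¹ᵁ U) :=
  (X.presheaf.map (homOfLE (π.preimage_mono h)).op).hom

/-- `π : X ⟶ Y` with the action `ρ` is an abelian cover with group `G`: `π` is finite, the action
is faithful, and `Y = X / G`. The last condition says that `π` is surjective, that
points in the same fibre of `π` lie in the same orbit, and that `𝒪_Y` is, via `π`, the sheaf of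
`G`-invariant sections of `π_* 𝒪_X` (the topology of `Y` is then the quotient topology since a
finite morphism is closed). -/
structure IsGCover (ρ : G →* Aut (Over.mk π)) : Prop where
  isFinite : IsFinite π
  faithful : Function.Injective ρ
  surjective : Function.Surjective π
  exists_act_eq : ∀ x x' : X, π x = π x' → ∃ g : G, act ρ g x = x'
  injective_app : ∀ U : Y.Opens, Function.Injective (π.app U).hom
  mem_range_app_iff : ∀ (U : Y.Opens) (f : Γ(X, π ⁻¹ᵁ U)),
    f ∈ (π.app U).hom.range ↔ ∀ g : G, pull ρ g U f = f

/-- The stabilizer of a geometric point supported at `x`: the group of those `g` that fix `x` and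
act trivially on its residue field. For a closed point of a variety over an algebraically closed
field this is the set-theoretic stabilizer `{g | g x = x}`. -/
def stabilizer (ρ : G →* Aut (Over.mk π)) (x : X) : Subgroup G where
  carrier := {g | X.fromSpecResidueField x ≫ act ρ g = X.fromSpecResidueField x}
  one_mem' := by simp [act_one]
  mul_mem' := by
    intro a b ha hb
    simp only [Set.mem_ofPred_eq] at *
    rw [act_mul, ← Category.assoc, hb, ha]
  inv_mem' := by
    intro a ha
    simp only [Set.mem_ofPred_eq] at *
    conv_lhs => rw [← ha]
    rw [Category.assoc, ← act_mul, inv_mul_cancel, act_one, Category.comp_id]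

/-- The ramification locus `R`: the points of `X` with non-trivial stabilizer. -/
def ramificationLocus (ρ : G →* Aut (Over.mk π)) : Set X := {x | stabilizer ρ x ≠ ⊥}

/-- The branch locus `D = π(R)`. -/
def branchLocus (ρ : G →* Aut (Over.mk π)) : Set Y := π '' ramificationLocus ρ

/-- The inertia group of a subset `T` of `X`: the elements of `G` fixing all points of `T`. -/
def inertia (ρ : G →* Aut (Over.mk π)) (T : Set X) : Subgroup G := ⨅ x ∈ T, stabilizer ρ x

/-- The irreducible closed set `T` has inertia group `H`, and `H` acts on the normal direction to
`T` by the character `ψ`: if `η` is the generic point of `T` and `𝔪` the maximal ideal of the local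
ring of `X` at `η`, then every `h ∈ H` acts on the conormal space `𝔪 / 𝔪 ^ 2` of `T` as
multiplication by `ψ h` (functions being acted on by pull-back). -/
def HasInertiaDatum {k : Type u} [Field k] (q : Y ⟶ Spec (.of k)) (ρ : G →* Aut (Over.mk π))
    (T : Set X) (H : Subgroup G) (ψ : H →* kˣ) : Prop :=
  inertia ρ T = H ∧
  ∃ η : X, IsGenericPoint η T ∧
    ∀ (h : H) (U : X.Opens) (hU : η ∈ U) (hU' : η ∈ act ρ (h : G) ⁻¹ᵁ U) (f : Γ(X, U)),
      X.presheaf.germ U η hU f ∈ IsLocalRing.maximalIdeal (X.presheaf.stalk η) →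
      X.presheaf.germ _ η hU' ((act ρ (h : G)).app U f) -
          X.presheaf.germ U η hU (scalar (π ≫ q) U (ψ h : k) * f) ∈
        IsLocalRing.maximalIdeal (X.presheaf.stalk η) ^ 2

/-- `T` is an irreducible component of the subset `S`. -/
def IsComponentOf {Z : Type u} [TopologicalSpace Z] (T S : Set Z) : Prop :=
  Maximal (fun T' : Set Z => IsIrreducible T' ∧ T' ⊆ S) T

/-- The divisor `D_{H,ψ}`, with its reduced structure and hence given by its underlying set: the
union of those irreducible components `E` of the branch locus such that the components of the
ramification locus over `E` have inertia group `H` and associated character `ψ`. -/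
def branchDivisor {k : Type u} [Field k] (q : Y ⟶ Spec (.of k)) (ρ : G →* Aut (Over.mk π))
    (H : Subgroup G) (ψ : H →* kˣ) : Set Y :=
  ⋃₀ {E | IsComponentOf E (branchLocus ρ) ∧
    ∃ T, IsComponentOf T (ramificationLocus ρ) ∧ π '' T = E ∧ HasInertiaDatum q ρ T H ψ}

/-- Sections over `U` of the summand `L_χ⁻¹` of `π_* 𝒪_X`, on which `G` acts via `χ`. -/
def eigenSections {k : Type u} [Field k] (q : Y ⟶ Spec (.of k)) (ρ : G →* Aut (Over.mk π))
    (χ : G →* kˣ) (U : Y.Opens) : AddSubgroup Γ(X, π ⁻¹ᵁ U) where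
  carrier := {f | ∀ g : G, pull ρ g U f = scalar (π ≫ q) (π ⁻¹ᵁ U) (χ g : k) * f}
  zero_mem' := by intro g; simp
  add_mem' := by intro a b ha hb g; rw [map_add, ha g, hb g, mul_add]
  neg_mem' := by intro a ha g; rw [map_neg, ha g, mul_neg]

theorem pull_res (ρ : G →* Aut (Over.mk π)) (g : G) {U V : Y.Opens} (h : U ≤ V)
    (f : Γ(X, π ⁻¹ᵁ V)) : pull ρ g U (res π h f) = res π h (pull ρ g V f) := by
  simp only [pull, res, ← CommRingCat.comp_apply, Scheme.Hom.map_appLE, Scheme.Hom.appLE_map]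

theorem pull_app (ρ : G →* Aut (Over.mk π)) (g : G) (U : Y.Opens) (a : Γ(Y, U)) :
    pull ρ g U (π.app U a) = π.app U a := by
  simp only [pull, ← CommRingCat.comp_apply, Scheme.Hom.app_eq_appLE,
    Scheme.Hom.appLE_comp_appLE, act_comp]

/-- The action of `𝒪_Y` on the summand `L_χ⁻¹` of `π_* 𝒪_X`. -/
def eigenSmul {k : Type u} [Field k] {q : Y ⟶ Spec (.of k)} {ρ : G →* Aut (Over.mk π)}
    {χ : G →* kˣ} {U : Y.Opens} (a : Γ(Y, U)) (f : eigenSections q ρ χ U) :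
    eigenSections q ρ χ U :=
  ⟨π.app U a * f.1, by intro g; rw [map_mul, f.2 g, pull_app, mul_left_comm]⟩

/-- The restriction maps of the summand `L_χ⁻¹` of `π_* 𝒪_X`. -/
def eigenRes {k : Type u} [Field k] {q : Y ⟶ Spec (.of k)} {ρ : G →* Aut (Over.mk π)}
    {χ : G →* kˣ} {U V : Y.Opens} (h : U ≤ V) (f : eigenSections q ρ χ V) :
    eigenSections q ρ χ U :=
  ⟨res π h f.1, by
    intro g
    rw [pull_res, f.2 g, map_mul]
    exact congrArg (· * _) (res_scalar (π ≫ q) (π.preimage_mono h) (χ g : k))⟩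

end Action

section TwoCovers

variable {G : Type v} [CommGroup G] {X X' Y : Scheme.{u}} {π : X ⟶ Y} {π' : X' ⟶ Y}

/-- An isomorphism of `𝒪_Y`-modules from the summand `L_χ⁻¹` of `π_* 𝒪_X` to the summand
`L'_χ⁻¹` of `π'_* 𝒪_X'`: additive bijections on sections over every open set, linear over `𝒪_Y`
and compatible with restriction. -/
structure EigensheafIso {k : Type u} [Field k] (q : Y ⟶ Spec (.of k))
    (ρ : G →* Aut (Over.mk π)) (ρ' : G →* Aut (Over.mk π')) (χ : G →* kˣ) where
  toEquiv : ∀ U : Y.Opens, eigenSections q ρ χ U ≃+ eigenSections q ρ' χ U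
  map_smul : ∀ (U : Y.Opens) (a : Γ(Y, U)) (f : eigenSections q ρ χ U),
    toEquiv U (eigenSmul a f) = eigenSmul a (toEquiv U f)
  map_res : ∀ (U V : Y.Opens) (h : U ≤ V) (f : eigenSections q ρ χ V),
    toEquiv U (eigenRes h f) = eigenRes h (toEquiv V f)

/-- Two `G`-covers of `Y` have the same building data: `L_χ ≅ L'_χ` for all characters `χ` of `G`
(expressed through the inverse line bundles, which are the summands of the direct images of the
structure sheaves), and `D_{H,ψ} = D'_{H,ψ}` for all subgroups `H` and characters `ψ` of `H`. -/
structure SameBuildingData {k : Type u} [Field k] (q : Y ⟶ Spec (.of k))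
    (ρ : G →* Aut (Over.mk π)) (ρ' : G →* Aut (Over.mk π')) : Prop where
  line : ∀ χ : G →* kˣ, Nonempty (EigensheafIso q ρ ρ' χ)
  branch : ∀ (H : Subgroup G) (ψ : H →* kˣ), branchDivisor q ρ H ψ = branchDivisor q ρ' H ψ

/-- The two covers become isomorphic over `f : U ⟶ Y`: there is a `G`-equivariant isomorphism of
schemes over `U` between their base changes. -/
def IsoOver (ρ : G →* Aut (Over.mk π)) (ρ' : G →* Aut (Over.mk π')) {U : Scheme.{u}}
    (f : U ⟶ Y) : Prop :=
  ∃ e : (Over.pullback f).obj (Over.mk π) ≅ (Over.pullback f).obj (Over.mk π'),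
    ∀ g : G, (Over.pullback f).map (ρ g).hom ≫ e.hom = e.hom ≫ (Over.pullback f).map (ρ' g).hom

end TwoCovers

end

end AbelianCover

/-!
The base change of the cover `X` to an affine open set `Spec A` of `Y` is the spectrum of a normal
domain `B` with `A = B ^ G`, and `B` is the direct sum of its eigenspaces `B_χ`, each of which is
isomorphic to the eigenspace `B'_χ` of the second cover by an `A`-linear map `φ_χ`. The `φ_χ` need
not be compatible with multiplication. However, `φ_α f * φ_β g` and `φ_{αβ} (f * g)` differ by an
element `c (α, β)` of the fraction field of `A` which does not depend on `f` and `g`, because the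
eigenspaces have rank one. The main point is that `c (α, β)` is a unit of `A`.

As `A` is normal and Noetherian, this may be verified at the primes `p` of `A` whose local ring is a
discrete valuation ring. Let `P` be a prime of `B` over `p`, with inertia group `H` and ramification
index `e`. Since the order of `G` is invertible, some eigenfunction `z` is a uniformizer at `P`; its
character restricts on `H` to the faithful character `ψ` of the conormal space. An eigenfunction for
`χ` of order `n` at `P` satisfies `χ = ψ ^ n` on `H`, so `χ` and `(H, ψ)` determine `n` modulo `e`, and
hence the smallest order of an element of `B_χ`, which is less than `e`. So this smallest order is
the same for both covers if they have the same pair `(H, ψ)` over `p`, and it follows that `φ_χ`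
preserves orders (`TameOrder.ord_map_eq`). Thus `c (α, β)` has order zero at `p`
(`exists_unit_mul_map_eq`).

The units `c (α, β)` form a symmetric 2-cocycle on the character group. It becomes a coboundary
after base change to the twisted group algebra `A₁ = ⨁ A e_χ`, in which the `e_χ` are units and
`e_α e_β = d (α, β) e_{αβ}`, with `d` the inverse of `c` normalized by the constant `c (1, 1)`. This algebra is étale over `A`, again because the order of `G` is invertible
(`TwistedAlgebra.etale`), and faithful. Correcting `φ_χ` by `e_χ` gives an equivariant isomorphism of
algebras `A₁ ⊗ B ≃ A₁ ⊗ B'` (`exists_etale_algEquiv`).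

It remains to translate the geometric data into algebra. The stabilizer of a point `x` over `Spec A`
is the inertia group of the corresponding prime (`mem_stabilizer_iff`), and a uniformizing
eigenfunction computes the character of the conormal space at `x` (`hasInertiaDatum_iff`). The branch
locus lies in a proper closed subset, so a point of codimension one of the branch locus is the
generic point of a component; therefore equality of the divisors `D_{H,ψ}` says that both covers have
the same inertia data at all points of codimension one (`exists_hasInertiaAt_of_branchDivisor_eq`).
Normality of `A` follows from that of `B`, as `A = B ^ G`.
-/

namespace AbelianCover

noncomputable section

set_option linter.unusedSectionVars false

/-! ### Cocycles and twisted group algebras -/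

/-- A normalized symmetric 2-cocycle on the commutative group `Γ` with values in the units of `A`,
for the trivial action. -/
structure SymmCocycle (Γ A : Type*) [CommGroup Γ] [CommRing A] where
  val : Γ → Γ → Aˣ
  symm : ∀ α β, val α β = val β α
  one_left : ∀ α, val 1 α = 1
  cocycle : ∀ α β γ, val α β * val (α * β) γ = val β γ * val α (β * γ)

/-- The group algebra of `Γ` over `A` twisted by a cocycle `c`: the free module on symbols
`e α`, `α : Γ`, with `e α * e β = c α β • e (α * β)`. Elements are encoded as coefficient functions,
so `e α` is `Pi.single α 1`. -/
def TwistedAlgebra {Γ A : Type*} [CommGroup Γ] [CommRing A] (_c : SymmCocycle Γ A) : Type _ := Γ → A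

namespace TwistedAlgebra

variable {Γ A : Type*} [CommGroup Γ] [CommRing A] (c : SymmCocycle Γ A)

instance : AddCommGroup (TwistedAlgebra c) := inferInstanceAs (AddCommGroup (Γ → A))
instance : Module A (TwistedAlgebra c) := inferInstanceAs (Module A (Γ → A))

variable {c} in
@[ext] theorem ext {x y : TwistedAlgebra c} (h : ∀ γ, x γ = y γ) : x = y := funext h

@[simp] theorem add_apply (x y : TwistedAlgebra c) (γ : Γ) : (x + y) γ = x γ + y γ := rfl
@[simp] theorem zero_apply (γ : Γ) : (0 : TwistedAlgebra c) γ = 0 := rfl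
@[simp] theorem smul_apply (a : A) (x : TwistedAlgebra c) (γ : Γ) : (a • x) γ = a * x γ := rfl

/-- The basis vector `e γ`. -/
def single [DecidableEq Γ] (γ : Γ) : TwistedAlgebra c := Pi.single (M := fun _ => A) γ 1

theorem single_apply [DecidableEq Γ] (γ δ : Γ) :
    single c γ δ = if δ = γ then 1 else 0 := by
  simp [single, Pi.single_apply]

instance [DecidableEq Γ] : One (TwistedAlgebra c) := ⟨single c 1⟩

theorem one_def [DecidableEq Γ] : (1 : TwistedAlgebra c) = single c 1 := rfl

variable [Fintype Γ]

instance : Mul (TwistedAlgebra c) where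
  mul x y := fun γ => ∑ α, (c.val α (α⁻¹ * γ) : A) * x α * y (α⁻¹ * γ)

theorem mul_apply (x y : TwistedAlgebra c) (γ : Γ) :
    (x * y) γ = ∑ α, (c.val α (α⁻¹ * γ) : A) * x α * y (α⁻¹ * γ) := rfl

theorem mul_comm' (x y : TwistedAlgebra c) : x * y = y * x := by
  ext γ
  rw [mul_apply, mul_apply]
  refine Fintype.sum_equiv ((Equiv.inv Γ).trans (Equiv.mulRight γ)) _ _ fun α => ?_
  simp only [Equiv.trans_apply, Equiv.inv_apply, Equiv.coe_mulRight, mul_inv_rev, inv_inv]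
  rw [show γ⁻¹ * α * γ = α by rw [mul_comm, mul_inv_cancel_left], c.symm]
  ring

theorem mul_assoc' (x y z : TwistedAlgebra c) : x * y * z = x * (y * z) := by
  ext γ
  simp only [mul_apply, Finset.sum_mul, Finset.mul_sum]
  rw [Finset.sum_comm]
  refine Finset.sum_congr rfl fun α _ => ?_
  refine Fintype.sum_equiv (Equiv.mulLeft α⁻¹) _ _ fun β => ?_
  simp only [Equiv.coe_mulLeft, mul_inv_rev, inv_inv]
  have h := congrArg (Units.val) (c.cocycle α (α⁻¹ * β) (β⁻¹ * γ))
  simp only [mul_inv_cancel_left, Units.val_mul, mul_assoc] at h ⊢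
  linear_combination x α * y (α⁻¹ * β) * z (β⁻¹ * γ) * h

variable [DecidableEq Γ]

theorem one_mul' (x : TwistedAlgebra c) : 1 * x = x := by
  ext γ
  rw [mul_apply, Finset.sum_eq_single 1]
  · simp [one_def, single_apply, c.one_left]
  · intro α _ h
    simp [one_def, single_apply, h]
  · simp

instance : CommRing (TwistedAlgebra c) where
  __ := (inferInstance : AddCommGroup (TwistedAlgebra c))
  left_distrib x y z := by
    ext γ; simp only [mul_apply, add_apply, mul_add, Finset.sum_add_distrib]
  right_distrib x y z := by
    ext γ; simp only [mul_apply, add_apply, mul_add, add_mul, Finset.sum_add_distrib]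
  zero_mul x := by ext γ; simp [mul_apply]
  mul_zero x := by ext γ; simp [mul_apply]
  mul_assoc := mul_assoc' c
  one_mul := one_mul' c
  mul_one x := by rw [mul_comm', one_mul']
  mul_comm := mul_comm' c

instance : Algebra A (TwistedAlgebra c) :=
  Algebra.ofModule
    (fun a x y => by ext γ; simp only [mul_apply, smul_apply, Finset.mul_sum]; congr! 1; ring)
    (fun a x y => by ext γ; simp only [mul_apply, smul_apply, Finset.mul_sum]; congr! 1; ring)

theorem single_mul_single (α β : Γ) :
    single c α * single c β = (c.val α β : A) • single c (α * β) := by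
  ext γ
  rw [mul_apply, Finset.sum_eq_single α]
  · by_cases h : γ = α * β
    · subst h; simp [single_apply]
    · have : α⁻¹ * γ ≠ β := by rintro rfl; simp at h
      simp [single_apply, h, this]
  · intro δ _ h
    simp [single_apply, h]
  · simp

instance : Module.Free A (TwistedAlgebra c) := inferInstanceAs (Module.Free A (Γ → A))
instance : Module.Finite A (TwistedAlgebra c) := inferInstanceAs (Module.Finite A (Γ → A))

theorem algebraMap_injective : Function.Injective (algebraMap A (TwistedAlgebra c)) := by
  intro a b h
  have := congrFun h (1 : Γ)
  simpa [Algebra.algebraMap_eq_smul_one, one_def, single_apply] using this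

theorem isUnit_single (γ : Γ) : IsUnit (single c γ) := by
  have h : single c γ * single c γ⁻¹ = algebraMap A _ (c.val γ γ⁻¹ : A) := by
    rw [single_mul_single, mul_inv_cancel, Algebra.algebraMap_eq_smul_one, one_def]
  exact isUnit_of_mul_isUnit_left (h ▸ (c.val γ γ⁻¹).isUnit.map _)

theorem exists_single_pow (γ : Γ) (n : ℕ) : ∃ a : A, single c γ ^ n = a • single c (γ ^ n) := by
  induction n with
  | zero => exact ⟨1, by rw [one_smul, pow_zero, pow_zero, one_def]⟩
  | succ n ih =>
    obtain ⟨a, ha⟩ := ih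
    exact ⟨a * c.val (γ ^ n) γ, by
      rw [pow_succ, ha, smul_mul_assoc, single_mul_single, smul_smul, pow_succ]⟩

theorem eq_sum_smul_single (x : TwistedAlgebra c) : x = ∑ γ, x γ • single c γ := by
  refine (pi_eq_sum_univ (R := A) (ι := Γ) x).trans ?_
  refine Finset.sum_congr rfl fun γ _ => ?_
  ext δ
  simp [single_apply, eq_comm]

/-- Each `e γ` has a power in the base ring; as it is a unit and the order of `Γ` is invertible,
its differential vanishes. -/
theorem formallyUnramified (h : IsUnit (Fintype.card Γ : A)) :
    Algebra.FormallyUnramified A (TwistedAlgebra c) := by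
  have key (γ : Γ) : KaehlerDifferential.D A (TwistedAlgebra c) (single c γ) = 0 := by
    obtain ⟨a, ha⟩ := exists_single_pow c γ (Fintype.card Γ)
    rw [pow_card_eq_one, ← one_def] at ha
    have h0 := congrArg (KaehlerDifferential.D A (TwistedAlgebra c)) ha
    rw [Derivation.leibniz_pow, Derivation.map_smul, Derivation.map_one_eq_zero, smul_zero,
      ← Nat.cast_smul_eq_nsmul (TwistedAlgebra c), smul_smul] at h0
    have hu : IsUnit (((Fintype.card Γ : ℕ) : TwistedAlgebra c)
        * single c γ ^ (Fintype.card Γ - 1)) := by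
      refine IsUnit.mul ?_ ((isUnit_single c γ).pow _)
      simpa using h.map (algebraMap A (TwistedAlgebra c))
    exact hu.smul_eq_zero.mp h0
  have hD : KaehlerDifferential.D A (TwistedAlgebra c) = 0 := by
    ext x
    rw [eq_sum_smul_single c x, map_sum]
    simp [key]
  rw [Algebra.formallyUnramified_iff, ← Submodule.subsingleton_iff (TwistedAlgebra c),
    ← subsingleton_iff_bot_eq_top, ← KaehlerDifferential.span_range_derivation, hD,
    eq_comm, Submodule.span_eq_bot]
  rintro _ ⟨x, rfl⟩
  rfl

theorem etale [IsNoetherianRing A] (h : IsUnit (Fintype.card Γ : A)) :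
    Algebra.Etale A (TwistedAlgebra c) := by
  have := formallyUnramified c h
  have : Algebra.FinitePresentation A (TwistedAlgebra c) :=
    Algebra.FinitePresentation.of_finiteType.mp inferInstance
  exact Algebra.Etale.of_formallyUnramified_of_flat

end TwistedAlgebra

/-! ### Discrete valuations at primes and normality -/

section Order

open IsLocalRing

/-- If a prime of a Noetherian domain becomes principal and nonzero in its local ring, then the local
ring is a discrete valuation ring. -/
theorem isDiscreteValuationRing_of_generator {B : Type*} [CommRing B] [IsDomain B]
    [IsNoetherianRing B] (P : Ideal B) [P.IsPrime] {z : B} (hz : z ∈ P) (hz0 : z ≠ 0)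
    (h : ∀ b ∈ P, ∃ s ∉ P, ∃ a, s * b = z * a) :
    IsDiscreteValuationRing (Localization.AtPrime P) := by
  have : IsNoetherianRing (Localization.AtPrime P) :=
    IsLocalization.isNoetherianRing P.primeCompl _ inferInstance
  have hinj : Function.Injective (algebraMap B (Localization.AtPrime P)) :=
    IsLocalization.injective _ P.primeCompl_le_nonZeroDivisors
  have hmem (b : B) : algebraMap B (Localization.AtPrime P) b ∈ maximalIdeal _ ↔ b ∈ P :=
    IsLocalization.AtPrime.to_map_mem_maximal_iff _ P b
  have hne : maximalIdeal (Localization.AtPrime P) ≠ ⊥ := by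
    intro h0
    have := (hmem z).mpr hz
    rw [h0, Ideal.mem_bot] at this
    exact hz0 (hinj (by rw [this, map_zero]))
  refine ((IsDiscreteValuationRing.TFAE _ (isField_iff_maximalIdeal_eq.not.mpr hne)).out 0 4).mpr ?_
  refine ⟨⟨algebraMap B _ z, le_antisymm ?_ ?_⟩⟩
  · intro x hx
    obtain ⟨b, t, rfl⟩ := IsLocalization.exists_mk'_eq P.primeCompl x
    have hb : b ∈ P := (IsLocalization.AtPrime.mk'_mem_maximal_iff _ P b t).mp hx
    obtain ⟨s, hs, a, e⟩ := h b hb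
    have hbm : algebraMap B (Localization.AtPrime P) b ∈ Ideal.span {algebraMap B _ z} := by
      have hu := (IsLocalization.AtPrime.isUnit_to_map_iff (Localization.AtPrime P) P s).mpr hs
      rw [Ideal.mem_span_singleton, ← hu.dvd_mul_left, ← map_mul, e, map_mul]
      exact dvd_mul_right _ _
    rw [IsLocalization.mk'_eq_mul_mk'_one]
    exact Ideal.mul_mem_right _ _ hbm
  · rw [Ideal.span_le, Set.singleton_subset_iff]
    exact (hmem z).mpr hz

variable {B : Type*} [CommRing B] [IsDomain B] (P : Ideal B) [P.IsPrime]
  [IsDiscreteValuationRing (Localization.AtPrime P)]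

/-- The order of vanishing along a prime `P` at which the local ring is a discrete valuation
ring. -/
def ordAt : AddValuation B ℕ∞ :=
  (IsDiscreteValuationRing.addVal (Localization.AtPrime P)).comap
    (algebraMap B (Localization.AtPrime P))

theorem ordAt_apply (b : B) : ordAt P b =
  IsDiscreteValuationRing.addVal (Localization.AtPrime P) (algebraMap B _ b) := rfl

theorem ordAt_eq_top_iff {b : B} : ordAt P b = ⊤ ↔ b = 0 := by
  rw [ordAt_apply, IsDiscreteValuationRing.addVal_eq_top_iff]
  exact map_eq_zero_iff _ (IsLocalization.injective _ P.primeCompl_le_nonZeroDivisors)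

theorem ordAt_eq_zero_iff {b : B} : ordAt P b = 0 ↔ b ∉ P := by
  rw [ordAt_apply, IsDiscreteValuationRing.addVal_eq_zero_iff,
    IsLocalization.AtPrime.isUnit_to_map_iff _ P]
  rfl

theorem one_le_ordAt_iff {b : B} : 1 ≤ ordAt P b ↔ b ∈ P := by
  rw [Order.one_le_iff_ne_zero, Ne, ordAt_eq_zero_iff, not_not]

theorem exists_of_ordAt_le {b c : B} (h : ordAt P b ≤ ordAt P c) :
    ∃ s ∉ P, ∃ d, s * c = b * d := by
  rw [ordAt_apply, ordAt_apply, IsDiscreteValuationRing.addVal_le_iff_dvd] at h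
  obtain ⟨y, hy⟩ := h
  obtain ⟨d, s, rfl⟩ := IsLocalization.exists_mk'_eq P.primeCompl y
  refine ⟨s, s.2, d, ?_⟩
  rw [IsLocalization.mul_mk'_eq_mk'_of_mul, IsLocalization.eq_mk'_iff_mul_eq, ← map_mul] at hy
  rw [mul_comm]
  exact IsLocalization.injective _ P.primeCompl_le_nonZeroDivisors hy

theorem exists_ordAt_eq_one : ∃ b, ordAt P b = 1 := by
  obtain ⟨ϖ, hϖ⟩ := IsDiscreteValuationRing.exists_irreducible (Localization.AtPrime P)
  obtain ⟨b, t, rfl⟩ := IsLocalization.exists_mk'_eq P.primeCompl ϖ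
  refine ⟨b, ?_⟩
  have := IsDiscreteValuationRing.addVal_uniformizer hϖ
  rw [ordAt_apply, ← IsLocalization.mk'_spec (Localization.AtPrime P) b t,
    IsDiscreteValuationRing.addVal_mul, this]
  have ht : ordAt P (t : B) = 0 := (ordAt_eq_zero_iff P).mpr t.2
  rw [ordAt_apply] at ht
  rw [ht, add_zero]

theorem ordAt_eq_one_iff {z : B} :
    ordAt P z = 1 ↔ z ≠ 0 ∧ z ∈ P ∧ ∀ b ∈ P, ∃ s ∉ P, ∃ a, s * b = z * a := by
  constructor
  · intro h
    refine ⟨fun h0 => ?_, (one_le_ordAt_iff P).mp h.ge, fun b hb => ?_⟩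
    · rw [(ordAt_eq_top_iff P).mpr h0] at h
      exact absurd h (by simp)
    · exact exists_of_ordAt_le P (h.trans_le ((one_le_ordAt_iff P).mpr hb))
  · rintro ⟨h0, hz, h⟩
    refine le_antisymm ?_ ((one_le_ordAt_iff P).mpr hz)
    obtain ⟨b, hb1⟩ := exists_ordAt_eq_one P
    obtain ⟨s, hs, a, e⟩ := h b ((one_le_ordAt_iff P).mp hb1.ge)
    have := congrArg (ordAt P) e
    rw [AddValuation.map_mul, AddValuation.map_mul, (ordAt_eq_zero_iff P).mpr hs, hb1, zero_add] at this
    rw [this]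
    exact le_self_add

end Order

section Normal

/-- In a normal Noetherian domain, divisibility can be checked at the primes whose local ring is a
discrete valuation ring. -/
theorem dvd_of_forall_prime {A : Type*} [CommRing A] [IsDomain A] [IsNoetherianRing A]
    [IsIntegrallyClosed A] {a b : A} (ha : a ≠ 0)
    (h : ∀ (p : Ideal A) [p.IsPrime], IsDiscreteValuationRing (Localization.AtPrime p) →
      ∃ s ∉ p, a ∣ s * b) : a ∣ b := by
  by_contra hab
  have hb0 : Ideal.Quotient.mk (Ideal.span {a}) b ≠ 0 := by
    rwa [Ne, Ideal.Quotient.eq_zero_iff_dvd]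
  -- a prime `p` associated to `A / a`, consisting of the `r` with `a ∣ r * y`
  obtain ⟨p, hp, hbp⟩ := exists_le_isAssociatedPrime_of_isNoetherianRing A _ hb0
  have hpp : p.IsPrime := hp.1
  obtain ⟨-, yq, hy⟩ := isAssociatedPrime_iff.mp hp
  obtain ⟨y, rfl⟩ := Ideal.Quotient.mk_surjective yq
  have hy (r : A) : r ∈ p ↔ a ∣ r * y := by
    rw [hy, Submodule.mem_colon_singleton, Submodule.mem_bot, Algebra.smul_def,
      Ideal.Quotient.algebraMap_eq, ← map_mul, Ideal.Quotient.eq_zero_iff_dvd]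
  have hya : ¬ a ∣ y := by
    intro h'
    exact hpp.ne_top ((Ideal.eq_top_iff_one _).mpr ((hy 1).mpr (by rwa [one_mul])))
  have hap : a ∈ p := (hy a).mpr (dvd_mul_right _ _)
  -- otherwise `y / a` maps `p` to itself, so it is integral over `A`, and `a ∣ y`
  have key : ∃ m ∈ p, ∃ k ∉ p, m * y = a * k := by
    by_contra! hcon
    let K := FractionRing A
    have haK : algebraMap A K a ≠ 0 := IsFractionRing.to_map_eq_zero_iff.not.mpr ha
    have hint := isIntegral_of_smul_mem_submodule (R := A)
      (N := Submodule.map (Algebra.linearMap A K) p) (by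
        rw [Submodule.ne_bot_iff]
        exact ⟨_, ⟨a, hap, rfl⟩, haK⟩) ((IsNoetherian.noetherian p).map _)
      (algebraMap A K y / algebraMap A K a) (by
        rintro _ ⟨m, hm, rfl⟩
        obtain ⟨k, hk⟩ := (hy m).mp hm
        refine ⟨k, by_contra fun hkp => hcon m hm k hkp hk, ?_⟩
        rw [Algebra.linearMap_apply, Algebra.linearMap_apply, smul_eq_mul, ← mul_div_right_comm,
          eq_div_iff haK, ← map_mul, ← map_mul, mul_comm y, hk, mul_comm])
    obtain ⟨x, e⟩ := IsIntegrallyClosed.algebraMap_eq_of_integral hint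
    rw [eq_div_iff haK, ← map_mul] at e
    exact hya ⟨x, by rw [mul_comm a, IsFractionRing.injective A K e]⟩
  obtain ⟨m, hm, k, hk, hmk⟩ := key
  have hm0 : m ≠ 0 := by
    rintro rfl
    rw [zero_mul, eq_comm, mul_eq_zero] at hmk
    rcases hmk with h' | h'
    · exact ha h'
    · exact hk (h' ▸ p.zero_mem)
  -- such an `m` generates the maximal ideal of the local ring at `p`
  have hdvr := isDiscreteValuationRing_of_generator p hm hm0 fun m' hm' => by
    obtain ⟨k', hk'⟩ := (hy m').mp hm'
    refine ⟨k, hk, k', mul_left_cancel₀ ha ?_⟩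
    linear_combination m * hk' - m' * hmk
  obtain ⟨s, hs, hsd⟩ := h p hdvr
  refine hs (hbp ?_)
  rw [Submodule.mem_colon_singleton, Submodule.mem_bot, Algebra.smul_def,
      Ideal.Quotient.algebraMap_eq, ← map_mul, Ideal.Quotient.eq_zero_iff_dvd]
  exact hsd

theorem eq_of_le_of_isDiscreteValuationRing {A : Type*} [CommRing A] [IsDomain A] (p : Ideal A)
    [p.IsPrime] [IsDiscreteValuationRing (Localization.AtPrime p)] {q : Ideal A} [q.IsPrime]
    (hq : q ≠ ⊥) (h : q ≤ p) : q = p := by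
  refine le_antisymm h fun c hc => ?_
  obtain ⟨b, hb, hb0⟩ := (Submodule.ne_bot_iff q).mp hq
  obtain ⟨t, ht⟩ := exists_ordAt_eq_one p
  obtain ⟨n, hn⟩ := ENat.ne_top_iff_exists.mp ((ordAt_eq_top_iff p).not.mpr hb0)
  have hle : ordAt p b ≤ ordAt p (t ^ n) := by
    rw [AddValuation.map_pow, ht, ← hn, nsmul_one]
  obtain ⟨s, hs, d, e⟩ := exists_of_ordAt_le p hle
  have htq : t ∈ q := by
    have : s * t ^ n ∈ q := e ▸ q.mul_mem_right _ hb
    exact ‹q.IsPrime›.mem_of_pow_mem n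
      ((‹q.IsPrime›.mem_or_mem this).resolve_left fun h' => hs (h h'))
  obtain ⟨s', hs', a, e'⟩ := ((ordAt_eq_one_iff p).mp ht).2.2 c hc
  have : s' * c ∈ q := e' ▸ q.mul_mem_right _ htq
  exact (‹q.IsPrime›.mem_or_mem this).resolve_left fun h' => hs' (h h')

theorem ne_bot_of_isDiscreteValuationRing {A : Type*} [CommRing A] [IsDomain A] (p : Ideal A)
    [p.IsPrime] [IsDiscreteValuationRing (Localization.AtPrime p)] : p ≠ ⊥ := by
  obtain ⟨t, ht⟩ := exists_ordAt_eq_one p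
  have h := (ordAt_eq_one_iff p).mp ht
  exact fun h0 => h.1 (by simpa [h0] using h.2.1)

theorem eq_of_le_of_under_eq {A B : Type*} [CommRing A] [CommRing B] [Algebra A B]
    [Algebra.IsIntegral A B] {P Q : Ideal B} [Q.IsPrime] (h : Q ≤ P)
    (e : Q.under A = P.under A) : Q = P := by
  by_contra hne
  exact (Ideal.IsIntegral.comap_lt_comap (R := A) (lt_of_le_of_ne h hne)).ne e

/-- The local rings of a normal finite extension `B` of `A` at primes over a prime of `A` with
discrete valuation local ring are discrete valuation rings. -/
theorem isDiscreteValuationRing_of_under_eq {A B : Type*} [CommRing A] [IsDomain A] [CommRing B]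
    [IsDomain B] [Algebra A B] [FaithfulSMul A B] [Algebra.IsIntegral A B] [IsNoetherianRing B]
    [IsIntegrallyClosed B] (p : Ideal A) [p.IsPrime]
    [IsDiscreteValuationRing (Localization.AtPrime p)] (P : Ideal B) [P.IsPrime]
    (hP : P.under A = p) : IsDiscreteValuationRing (Localization.AtPrime P) := by
  open IsLocalRing in
  have hPbot : P ≠ ⊥ := by
    rintro rfl
    refine ne_bot_of_isDiscreteValuationRing p (hP ▸ ?_)
    rw [Ideal.under_def, Ideal.comap_bot_of_injective _ (FaithfulSMul.algebraMap_injective A B)]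
  have hinj : Function.Injective (algebraMap B (Localization.AtPrime P)) :=
    IsLocalization.injective _ P.primeCompl_le_nonZeroDivisors
  have : IsNoetherianRing (Localization.AtPrime P) :=
    IsLocalization.isNoetherianRing P.primeCompl _ inferInstance
  have hcomap : (maximalIdeal (Localization.AtPrime P)).under B = P :=
    IsLocalization.AtPrime.under_maximalIdeal _ P
  have hne : maximalIdeal (Localization.AtPrime P) ≠ ⊥ := by
    intro h0
    rw [h0, Ideal.under_def, Ideal.comap_bot_of_injective _ hinj] at hcomap
    exact hPbot hcomap.symm
  refine ((IsDiscreteValuationRing.TFAE _ (isField_iff_maximalIdeal_eq.not.mpr hne)).out 0 3).mpr ?_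
  refine ⟨isIntegrallyClosed_of_isLocalization _ P.primeCompl P.primeCompl_le_nonZeroDivisors,
    maximalIdeal _, ⟨hne, inferInstance⟩, ?_⟩
  rintro M ⟨hM, hMp⟩
  have hle : M.under B ≤ P := by
    conv_rhs => rw [← hcomap]
    exact Ideal.comap_mono (le_maximalIdeal hMp.ne_top)
  have hMb : M.under B ≠ ⊥ := by
    intro h0
    apply hM
    rw [← IsLocalization.map_under P.primeCompl _ M, h0, Ideal.map_bot]
  -- a nonzero prime below `P` lies over `p`, and there are no inclusions between primes over `p`
  have hMu : (M.under B).under A = p := by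
    refine eq_of_le_of_isDiscreteValuationRing p (Ideal.under_ne_bot A hMb) ?_
    rw [← hP]
    exact Ideal.comap_mono hle
  have := eq_of_le_of_under_eq (A := A) hle (hMu.trans hP.symm)
  rw [← IsLocalization.map_under P.primeCompl _ M]
  exact (congrArg (Ideal.map _) (this.trans hcomap.symm)).trans
    (IsLocalization.map_under P.primeCompl _ _)

end Normal

/-! ### Eigenspaces of a group of automorphisms -/

theorem inv_mem_of_finite {Γ : Type*} [Group Γ] [Finite Γ] (M : Submonoid Γ) {x : Γ}
    (hx : x ∈ M) : x⁻¹ ∈ M := by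
  rw [inv_eq_of_mul_eq_one_right (b := x ^ (orderOf x - 1))]
  · exact M.pow_mem hx _
  · rw [mul_pow_sub_one (orderOf_pos x).ne', pow_orderOf_eq_one]

section Eigen

variable (k A : Type*) {B G : Type*} [Field k] [CommRing A] [CommRing B] [Algebra k A]
  [Algebra k B] [Algebra A B] [IsScalarTower k A B] [CommGroup G] [MulSemiringAction G B]
  [SMulCommClass G A B]

include k A in
theorem smul_scalar_smul (g : G) (c : k) (b : B) : g • c • b = c • g • b := by
  rw [← algebraMap_smul A c b, smul_comm, algebraMap_smul]

theorem smul_algebraMap_eq (g : G) (a : A) : g • algebraMap A B a = algebraMap A B a := by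
  rw [Algebra.algebraMap_eq_smul_one, smul_comm, smul_one]

variable {k} in
/-- The `A`-submodule of `B` on which `G` acts through the character `χ`. -/
def eigen (χ : G →* kˣ) : Submodule A B where
  carrier := {f | ∀ g : G, g • f = (χ g : k) • f}
  zero_mem' g := by simp
  add_mem' ha hb g := by rw [smul_add, ha g, hb g, smul_add]
  smul_mem' a f hf g := by rw [smul_comm, hf g, smul_comm]

variable {k A}

theorem mem_eigen {χ : G →* kˣ} {f : B} : f ∈ eigen A χ ↔ ∀ g : G, g • f = (χ g : k) • f := Iff.rfl

theorem mul_mem_eigen {χ η : G →* kˣ} {f g : B} (hf : f ∈ eigen A χ) (hg : g ∈ eigen A η) :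
    f * g ∈ eigen A (χ * η) := fun x => by
  rw [smul_mul', hf x, hg x, MonoidHom.mul_apply, Units.val_mul, smul_mul_smul_comm]

theorem algebraMap_mem_eigen_one (a : A) : algebraMap A B a ∈ eigen A (1 : G →* kˣ) := fun x => by
  rw [smul_algebraMap_eq, MonoidHom.one_apply, Units.val_one, one_smul]

theorem pow_mem_eigen {χ : G →* kˣ} {f : B} (hf : f ∈ eigen A χ) (n : ℕ) :
    f ^ n ∈ eigen A (χ ^ n) := by
  induction n with
  | zero =>
    rw [pow_zero, pow_zero χ, ← map_one (algebraMap A B)]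
    exact algebraMap_mem_eigen_one 1
  | succ n ih => rw [pow_succ, pow_succ χ]; exact mul_mem_eigen ih hf

variable [Fintype G]

variable (A) in
/-- The projection of `B` to its `χ`-eigenspace. -/
def eigenProj (χ : G →* kˣ) : B →ₗ[A] B where
  toFun b := (Fintype.card G : k)⁻¹ • ∑ g : G, (χ g⁻¹ : k) • g • b
  map_add' a b := by simp only [smul_add, Finset.sum_add_distrib]
  map_smul' a b := by
    simp only [RingHom.id_apply, Finset.smul_sum]
    refine Finset.sum_congr rfl fun g _ => ?_
    rw [smul_comm g a b, smul_comm _ a (g • b), smul_comm _ a _]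

theorem eigenProj_apply (χ : G →* kˣ) (b : B) :
    eigenProj A χ b = (Fintype.card G : k)⁻¹ • ∑ g : G, (χ g⁻¹ : k) • g • b := rfl

theorem eigenProj_mem (χ : G →* kˣ) (b : B) : eigenProj A χ b ∈ eigen A χ := fun x => by
  rw [eigenProj_apply, smul_scalar_smul k A, smul_comm (χ x : k) (_ : k) (_ : B)]
  congr 1
  rw [Finset.smul_sum, Finset.smul_sum]
  refine Fintype.sum_equiv (Equiv.mulLeft x) _ _ fun g : G => ?_
  rw [smul_scalar_smul k A, smul_smul, smul_smul, Equiv.coe_mulLeft, mul_inv_rev, map_mul,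
    Units.val_mul, mul_comm (χ g⁻¹ : k), ← mul_assoc, ← Units.val_mul, ← map_mul, mul_inv_cancel,
    map_one, Units.val_one, one_mul]

theorem eigenProj_mem_ideal (χ : G →* kˣ) {I : Ideal B} {b : B} (h : ∀ g : G, g • b ∈ I) :
    eigenProj A χ b ∈ I := by
  rw [eigenProj_apply]
  exact I.restrictScalars k |>.smul_mem _
    (Submodule.sum_mem _ fun g _ => (I.restrictScalars k).smul_mem _ (h g))

theorem eigenProj_of_mem_of_ne {χ η : G →* kˣ} (hne : χ ≠ η) {f : B} (hf : f ∈ eigen A η) :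
    eigenProj A χ f = 0 := by
  have (g : G) : (χ g⁻¹ : k) • g • f = (((χ⁻¹ * η) g : kˣ) : k) • f := by
    rw [hf g, smul_smul, MonoidHom.mul_apply, Units.val_mul, MonoidHom.inv_apply, map_inv]
  rw [eigenProj_apply, Finset.sum_congr rfl fun g _ => this g, ← Finset.sum_smul,
    show ∑ g : G, (((χ⁻¹ * η) g : kˣ) : k) = 0 from
      sum_hom_units_eq_zero ((Units.coeHom k).comp (χ⁻¹ * η)) fun h => hne ?_, zero_smul, smul_zero]
  have h1 : χ⁻¹ * η = 1 := by
    ext g; exact congrArg (fun f : G →* k => f g) h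
  exact (inv_mul_eq_one.mp h1)

section

variable (hG : (Fintype.card G : k) ≠ 0)
include hG

theorem eigenProj_of_mem {χ : G →* kˣ} {f : B} (hf : f ∈ eigen A χ) : eigenProj A χ f = f := by
  have (g : G) : (χ g⁻¹ : k) • g • f = f := by
    rw [hf g, smul_smul, ← Units.val_mul, ← map_mul, inv_mul_cancel, map_one, Units.val_one,
      one_smul]
  rw [eigenProj_apply, Finset.sum_congr rfl fun g _ => this g, Finset.sum_const, Finset.card_univ,
    ← Nat.cast_smul_eq_nsmul k, smul_smul, inv_mul_cancel₀ hG, one_smul]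

variable [Fintype (G →* kˣ)] [IsAlgClosed k]

theorem hasEnoughRootsOfUnity : HasEnoughRootsOfUnity k (Monoid.exponent G) := by
  have : NeZero ((Monoid.exponent G : ℕ) : k) := by
    refine ⟨fun h => hG ?_⟩
    obtain ⟨m, hm⟩ := Group.exponent_dvd_card (G := G)
    rw [hm, Nat.cast_mul, h, zero_mul]
  exact IsSepClosed.hasEnoughRootsOfUnity k _

theorem sum_characters_apply [DecidableEq G] (g : G) :
    ∑ χ : G →* kˣ, (χ g : k) = if g = 1 then (Fintype.card G : k) else 0 := by
  have := hasEnoughRootsOfUnity hG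
  split_ifs with h
  · subst h
    simp only [map_one, Units.val_one, Finset.sum_const, Finset.card_univ, nsmul_one]
    rw [← Nat.card_eq_fintype_card, CommGroup.card_monoidHom_of_hasEnoughRootsOfUnity,
      Nat.card_eq_fintype_card]
  · obtain ⟨φ, hφ⟩ := CommGroup.exists_apply_ne_one_of_hasEnoughRootsOfUnity G k h
    have h2 : (φ g : k) * ∑ χ : G →* kˣ, (χ g : k) = ∑ χ : G →* kˣ, (χ g : k) := by
      rw [Finset.mul_sum]
      exact Fintype.sum_equiv (Equiv.mulLeft φ) _ _ fun χ => by simp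
    by_contra hne
    exact hφ (Units.ext (mul_right_cancel₀ hne (h2.trans (one_mul _).symm)))

theorem sum_eigenProj (b : B) : ∑ χ : G →* kˣ, eigenProj A χ b = b := by
  classical
  simp only [eigenProj_apply]
  rw [← Finset.smul_sum, Finset.sum_comm]
  simp only [← Finset.sum_smul, sum_characters_apply hG, inv_eq_one, ite_smul, zero_smul]
  rw [Finset.sum_ite_eq' Finset.univ (1 : G), if_pos (Finset.mem_univ _), one_smul, smul_smul,
    inv_mul_cancel₀ hG, one_smul]

/-- Duality for finite abelian groups: a character killing every element killed by the subgroup `S`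
of characters lies in `S`. -/
theorem mem_of_forall_apply_eq_one (S : Subgroup (G →* kˣ)) {χ : G →* kˣ}
    (h : ∀ g : G, (∀ φ ∈ S, φ g = 1) → χ g = 1) : χ ∈ S := by
  have := hasEnoughRootsOfUnity hG
  have h1 : χ ∈ (CommGroup.subgroupOrderIsoSubgroupMonoidHom G k
      ((CommGroup.subgroupOrderIsoSubgroupMonoidHom G k).symm (OrderDual.toDual S))).ofDual := by
    rw [CommGroup.mem_subgroupOrderIsoSubgroupMonoidHom_iff]
    intro g hg
    rw [CommGroup.mem_subgroupOrderIsoSubgroupMonoidHom_symm_iff] at hg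
    exact h g hg
  rwa [OrderIso.apply_symm_apply] at h1

theorem smul_sub_mem_of_forall_eigen (I : Ideal B) (S : Set (G →* kˣ))
    (hS : ∀ η ∉ S, ∀ f ∈ eigen A η, (f : B) ∈ I) {g : G} (hg : ∀ φ ∈ S, φ g = 1) (b : B) :
    g • b - b ∈ I := by
  have : g • b - b = ∑ χ : G →* kˣ, (g • eigenProj A χ b - eigenProj A χ b) := by
    rw [Finset.sum_sub_distrib, ← Finset.smul_sum, sum_eigenProj hG]
  rw [this]
  refine I.sum_mem fun χ _ => ?_
  by_cases hχ : χ ∈ S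
  · rw [eigenProj_mem χ b g, hg χ hχ, Units.val_one, one_smul, sub_self]
    exact I.zero_mem
  · rw [eigenProj_mem χ b g]
    have := hS χ hχ _ (eigenProj_mem χ b)
    exact I.sub_mem ((I.restrictScalars k).smul_mem _ this) this

/-- A set of characters closed under products contains every character killing the elements of `G`
that it kills. -/
theorem mem_of_mul_mem (S : Set (G →* kˣ)) (h1 : 1 ∈ S)
    (hmul : ∀ φ ∈ S, ∀ φ' ∈ S, φ * φ' ∈ S) {χ : G →* kˣ}
    (h : ∀ g : G, (∀ φ ∈ S, φ g = 1) → χ g = 1) : χ ∈ S := by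
  let M : Submonoid (G →* kˣ) :=
    { carrier := S, one_mem' := h1, mul_mem' := fun {a b} ha hb => hmul a ha b hb }
  let T : Subgroup (G →* kˣ) :=
    { M with
      inv_mem' := fun {χ} hχ => inv_mem_of_finite M hχ }
  exact mem_of_forall_apply_eq_one hG T h

/-- If the action is faithful, then every eigenspace is nonzero. -/
theorem exists_ne_zero_mem_eigen [IsDomain B] (hfaith : ∀ g : G, (∀ b : B, g • b = b) → g = 1)
    (χ : G →* kˣ) : ∃ f ∈ eigen A χ, (f : B) ≠ 0 := by
  refine mem_of_mul_mem hG {χ | ∃ f ∈ eigen A χ, (f : B) ≠ 0} ⟨1, ?_, one_ne_zero⟩ ?_ ?_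
  · simpa using algebraMap_mem_eigen_one (k := k) (G := G) (B := B) (1 : A)
  · rintro φ ⟨f, hf, hf0⟩ φ' ⟨f', hf', hf0'⟩
    exact ⟨f * f', mul_mem_eigen hf hf', mul_ne_zero hf0 hf0'⟩
  · intro g hg
    rw [hfaith g fun b => ?_, map_one]
    have := smul_sub_mem_of_forall_eigen (A := A) hG ⊥ _ (fun η hη f hf => ?_) hg b
    · exact sub_eq_zero.mp this
    · by_contra hf0
      exact hη ⟨f, hf, hf0⟩

end

end Eigen

/-! ### Orders of eigenfunctions -/

section OrderAtPrime

open scoped Pointwise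

variable {k A B G : Type*} [Field k] [CommRing A] [CommRing B] [Algebra k A]
  [Algebra k B] [Algebra A B] [IsScalarTower k A B] [CommGroup G] [MulSemiringAction G B]
  [SMulCommClass G A B] [IsDomain A] [IsDomain B] [FaithfulSMul A B] [Finite G]
  [Algebra.IsInvariant A B G]
  (p : Ideal A) [p.IsPrime] [IsDiscreteValuationRing (Localization.AtPrime p)]
  (P : Ideal B) [P.IsPrime] [IsDiscreteValuationRing (Localization.AtPrime P)]

theorem ordAt_unit_smul (c : kˣ) (f : B) : ordAt P ((c : k) • f) = ordAt P f := by
  have hu : IsUnit (algebraMap k B c) := c.isUnit.map _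
  have h0 : ordAt P (algebraMap k B c) = 0 :=
    (ordAt_eq_zero_iff P).mpr fun h => ‹P.IsPrime›.ne_top (Ideal.eq_top_of_isUnit_mem _ h hu)
  rw [Algebra.smul_def, AddValuation.map_mul, h0, zero_add]

variable (G) in
/-- Divisibility in `B` by an element of `A`, locally at `p`, can be checked on all translates at one
prime over `p`, as `G` permutes these primes transitively. -/
theorem exists_smul_eq_of_forall_ordAt_le (hP : P.under A = p) (s : A) (b : B)
    (h : ∀ g : G, ordAt P (algebraMap A B s) ≤ ordAt P (g • b)) :
    ∃ t ∉ p, ∃ d : B, t • b = s • d := by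
  have : Algebra.IsIntegral A B := Algebra.IsInvariant.isIntegral A B G
  let I : Ideal B := Submodule.colon (Ideal.span {algebraMap A B s}) {b}
  have hI (x : B) : x ∈ I ↔ algebraMap A B s ∣ x * b := by
    rw [Submodule.mem_colon_singleton, Ideal.mem_span_singleton, smul_eq_mul]
  -- if `I` is contained in a prime over `p`, then this prime is a translate of `P`
  by_cases hle : I.comap (algebraMap A B) ≤ p
  · exfalso
    obtain ⟨Q, hQI, hQ, hQp⟩ := Ideal.exists_ideal_over_prime_of_isIntegral p I hle
    obtain ⟨g, rfl⟩ := Algebra.IsInvariant.exists_smul_of_under_eq A B G P Q (hP.trans hQp.symm)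
    obtain ⟨x, hx, d, e⟩ := exists_of_ordAt_le P (h g⁻¹)
    have e' := congrArg (g • ·) e
    simp only [smul_mul', smul_inv_smul, smul_algebraMap_eq] at e'
    have := hQI ((hI (g • x)).mpr ⟨_, e'⟩)
    rw [Ideal.smul_mem_pointwise_smul_iff] at this
    exact hx this
  · obtain ⟨t, ht, htp⟩ := SetLike.not_le_iff_exists.mp hle
    obtain ⟨d, hd⟩ := (hI _).mp ht
    exact ⟨t, htp, d, by rw [Algebra.smul_def, Algebra.smul_def, hd]⟩

theorem exists_mem_eigen_smul_eq (hP : P.under A = p) {s : A} (hs : s ≠ 0) {χ : G →* kˣ} {f : B}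
    (hf : f ∈ eigen A χ) (h : ordAt P (algebraMap A B s) ≤ ordAt P f) :
    ∃ t ∉ p, ∃ d ∈ eigen A χ, t • f = s • (d : B) := by
  obtain ⟨t, ht, d, e⟩ := exists_smul_eq_of_forall_ordAt_le G p P hP s f fun g => by
    rwa [hf g, ordAt_unit_smul]
  refine ⟨t, ht, d, fun g => ?_, e⟩
  have hsB : algebraMap A B s ≠ 0 :=
    (map_ne_zero_iff _ (FaithfulSMul.algebraMap_injective A B)).mpr hs
  refine mul_left_cancel₀ hsB ?_
  rw [← Algebra.smul_def, ← Algebra.smul_def, ← smul_comm g s d, ← e, smul_comm g t f, hf g,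
    smul_comm t, e, smul_comm s]

theorem algebraMap_notMem (hP : P.under A = p) {t : A} (ht : t ∉ p) : algebraMap A B t ∉ P := by
  rw [← hP] at ht; exact ht

theorem ordAt_algebraMap (hP : P.under A = p) {s : A} (hs : ordAt p s = 1) (a : A) :
    ordAt P (algebraMap A B a) = ordAt p a * ordAt P (algebraMap A B s) := by
  by_cases ha : a = 0
  · subst ha
    rw [map_zero, AddValuation.map_zero, AddValuation.map_zero, ENat.top_mul]
    rw [Ne, ordAt_eq_zero_iff, not_not]
    have : s ∈ P.under A := hP ▸ (one_le_ordAt_iff p).mp hs.ge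
    exact this
  obtain ⟨n, hn⟩ := ENat.ne_top_iff_exists.mp ((ordAt_eq_top_iff p).not.mpr ha)
  have hsn : ordAt p (s ^ n) = n := by rw [AddValuation.map_pow, hs, nsmul_one]
  obtain ⟨t, ht, d, e⟩ := exists_of_ordAt_le p (hsn.trans hn).le
  have hd : ordAt p d = 0 := by
    have h1 := congrArg (ordAt p) e
    rw [AddValuation.map_mul, AddValuation.map_mul, (ordAt_eq_zero_iff p).mpr ht, hsn, ← hn,
      zero_add] at h1
    exact ENat.add_right_injective_of_ne_top (ENat.natCast_ne_top n) (h1.symm.trans (add_zero _).symm)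
  have h2 := congrArg (fun x => ordAt P (algebraMap A B x)) e
  simp only [map_mul, map_pow, AddValuation.map_mul, AddValuation.map_pow] at h2
  rw [(ordAt_eq_zero_iff P).mpr (algebraMap_notMem p P hP ht),
    (ordAt_eq_zero_iff P).mpr (algebraMap_notMem p P hP ((ordAt_eq_zero_iff p).mp hd)), zero_add,
    add_zero] at h2
  rw [h2, ← hn, nsmul_eq_mul]

theorem exists_algebraMap_eq_of_mem_eigen_one {f : B} (hf : f ∈ eigen A (1 : G →* kˣ)) :
    ∃ a, algebraMap A B a = f :=
  Algebra.IsInvariant.isInvariant (G := G) f fun g => by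
    rw [hf g, MonoidHom.one_apply, Units.val_one, one_smul]

/-- Eigenfunctions with the same character have invariant quotient. -/
theorem exists_smul_eq_smul [Finite (G →* kˣ)] {η : G →* kˣ} {f f' : B} (hf : f ∈ eigen A η)
    (hf' : f' ∈ eigen A η) (h0 : f ≠ 0) (h0' : f' ≠ 0) :
    ∃ a b : A, a ≠ 0 ∧ b ≠ 0 ∧ a • f = b • f' := by
  have hη : 0 < orderOf η := orderOf_pos η
  have key (x : B) (hx : x ∈ eigen A η) : ∃ a : A, algebraMap A B a = x * f' ^ (orderOf η - 1) := by
    refine exists_algebraMap_eq_of_mem_eigen_one (k := k) (G := G) ?_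
    have := mul_mem_eigen hx (pow_mem_eigen hf' (orderOf η - 1))
    have h1 : η * η ^ (orderOf η - 1) = 1 :=
      (mul_pow_sub_one hη.ne' η).trans (pow_orderOf_eq_one η)
    rwa [h1] at this
  obtain ⟨a, ha⟩ := key f' hf'
  obtain ⟨b, hb⟩ := key f hf
  refine ⟨a, b, ?_, ?_, ?_⟩
  · rintro rfl
    rw [map_zero] at ha
    exact mul_ne_zero h0' (pow_ne_zero _ h0') ha.symm
  · rintro rfl
    rw [map_zero] at hb
    exact mul_ne_zero h0 (pow_ne_zero _ h0') hb.symm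
  · rw [Algebra.smul_def, Algebra.smul_def, ha, hb]; ring

/-- The inertia group acts on an eigenfunction of order `m` through the `m`-th power of the
character by which it acts on an eigenfunction of order one. -/
theorem apply_eq_pow_of_ordAt_eq {χ η : G →* kˣ} {z f : B} (hz : z ∈ eigen A χ)
    (hz1 : ordAt P z = 1) (hf : f ∈ eigen A η) {m : ℕ} (hfm : ordAt P f = m) {h : G}
    (hh : h ∈ P.inertia G) : η h = χ h ^ m := by
  have hzm : ordAt P (z ^ m) = m := by rw [AddValuation.map_pow, hz1, nsmul_one]
  obtain ⟨s, hs, a, e⟩ := exists_of_ordAt_le P (hzm.trans hfm.symm).le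
  have ha : a ∉ P := by
    rw [← ordAt_eq_zero_iff]
    have h1 := congrArg (ordAt P) e
    rw [AddValuation.map_mul, AddValuation.map_mul, (ordAt_eq_zero_iff P).mpr hs, hzm, hfm,
      zero_add] at h1
    exact ENat.add_right_injective_of_ne_top (ENat.natCast_ne_top m) (h1.symm.trans (add_zero _).symm)
  have hz0 : z ^ m ≠ 0 := pow_ne_zero _ ((ordAt_eq_one_iff P).mp hz1).1
  have e' := congrArg (h • ·) e
  simp only [smul_mul', hf h, pow_mem_eigen hz m h] at e'
  rw [Algebra.smul_def, Algebra.smul_def] at e'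
  have e2 : algebraMap k B (η h : k) * ((h • s) * a)
      = algebraMap k B ((χ ^ m) h : kˣ) * (s * (h • a)) := by
    refine mul_left_cancel₀ hz0 ?_
    linear_combination s * e' - algebraMap k B (η h : k) * (h • s) * e
  rw [MonoidHom.pow_apply] at e2
  by_contra hne
  have hu : IsUnit (algebraMap k B ((η h : k) - (χ h ^ m : kˣ))) := by
    refine IsUnit.map _ (sub_ne_zero.mpr fun h' => hne (Units.ext h')).isUnit
  have hmem : algebraMap k B ((η h : k) - (χ h ^ m : kˣ)) * (s * a) ∈ P := by
    have h1 := hh s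
    have h2 := hh a
    have : algebraMap k B ((η h : k) - (χ h ^ m : kˣ)) * (s * a)
      = algebraMap k B (χ h ^ m : kˣ) * s * (h • a - a)
        - algebraMap k B (η h : k) * a * (h • s - s) := by
      rw [map_sub]
      linear_combination e2
    rw [this]
    exact P.sub_mem (P.mul_mem_left _ h2) (P.mul_mem_left _ h1)
  rw [P.unit_mul_mem_iff_mem hu] at hmem
  exact (‹P.IsPrime›.mem_or_mem hmem).elim hs ha

end OrderAtPrime

/-! ### Inertia data determine the multiplication up to units -/

section Uniformizer

open scoped Pointwise

variable {k A B G : Type*} [Field k] [CommRing A] [CommRing B] [Algebra k A]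
  [Algebra k B] [Algebra A B] [IsScalarTower k A B] [CommGroup G] [MulSemiringAction G B]
  [SMulCommClass G A B] [IsDomain A] [IsDomain B] [FaithfulSMul A B] [Fintype G]
  [Fintype (G →* kˣ)] [IsAlgClosed k] (hG : (Fintype.card G : k) ≠ 0)
  [Algebra.IsInvariant A B G]
  (p : Ideal A) [p.IsPrime] [IsDiscreteValuationRing (Localization.AtPrime p)]
  (P : Ideal B) [P.IsPrime] [IsDiscreteValuationRing (Localization.AtPrime P)]

variable (G) in
/-- Such a `t` is the product of a uniformizer at `P` and an element that lies in every translate of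
`P` other than `P` itself, but not in `P`. -/
theorem exists_ordAt_eq_one_and_smul_mem : ∃ t : B, ordAt P t = 1 ∧ ∀ g : G, g • t ∈ P := by
  classical
  obtain ⟨t₀, ht₀⟩ := exists_ordAt_eq_one P
  let I := Finset.inf {g : G | g • P ≠ P} (fun g => g • P)
  have hI : ¬ I ≤ P := by
    rw [Ideal.IsPrime.inf_le' inferInstance]
    rintro ⟨g, hg1, hg2⟩
    exact (Finset.mem_filter.mp hg1).2 (smul_eq_of_smul_le hg2)
  obtain ⟨w, hw, hwP⟩ := SetLike.not_le_iff_exists.mp hI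
  refine ⟨t₀ * w, ?_, fun g => ?_⟩
  · rw [AddValuation.map_mul, ht₀, (ordAt_eq_zero_iff P).mpr hwP, add_zero]
  · rw [← Ideal.mem_inv_pointwise_smul_iff]
    by_cases hg : g⁻¹ • P = P
    · rw [hg]
      exact P.mul_mem_right _ ((one_le_ordAt_iff P).mp ht₀.ge)
    · refine Ideal.mul_mem_left _ _ ?_
      exact (Finset.inf_le (f := fun g => g • P) (by simpa using hg) : I ≤ g⁻¹ • P) hw

include hG in
variable (A) in
/-- Averaging a suitable uniformizer produces an eigenfunction of order one. -/
theorem exists_mem_eigen_ordAt_eq_one :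
    ∃ (χ : G →* kˣ), ∃ z ∈ eigen A χ, ordAt P (z : B) = 1 := by
  obtain ⟨t, ht, htP⟩ := exists_ordAt_eq_one_and_smul_mem G P
  by_contra! hcon
  have h2 : (2 : ℕ∞) ≤ ordAt P t := by
    rw [← sum_eigenProj (A := A) hG t]
    refine AddValuation.map_le_sum _ fun χ _ => ?_
    have h1 : 1 ≤ ordAt P (eigenProj A χ t) :=
      (one_le_ordAt_iff P).mpr (eigenProj_mem_ideal χ htP)
    have h3 := lt_of_le_of_ne h1 (hcon χ _ (eigenProj_mem χ t)).symm
    have := Order.add_one_le_of_lt h3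
    rwa [one_add_one_eq_two] at this
  rw [ht] at h2
  exact absurd h2 (by decide)

include hG in
variable (A) in
/-- The inertia group is cut out by the characters of eigenfunctions of order zero. -/
theorem exists_mem_eigen_notMem {η : G →* kˣ} (hη : ∀ h ∈ P.inertia G, η h = 1) :
    ∃ f ∈ eigen A η, (f : B) ∉ P := by
  refine mem_of_mul_mem hG {χ | ∃ f ∈ eigen A χ, (f : B) ∉ P} ⟨1, ?_, ?_⟩ ?_ ?_
  · rw [← map_one (algebraMap A B)]
    exact algebraMap_mem_eigen_one 1
  · exact fun h => ‹P.IsPrime›.ne_top ((Ideal.eq_top_iff_one _).mpr h)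
  · rintro φ ⟨f, hf, hf0⟩ φ' ⟨f', hf', hf0'⟩
    exact ⟨f * f', mul_mem_eigen hf hf', fun h => (‹P.IsPrime›.mem_or_mem h).elim hf0 hf0'⟩
  · intro g hg
    refine hη g fun b => smul_sub_mem_of_forall_eigen (A := A) hG P _ (fun η hη f hf => ?_) hg b
    by_contra hf0
    exact hη ⟨f, hf, hf0⟩

include hG in
/-- The ramification index is the order of the character `χ` of the inertia group on an
eigenfunction of order one. -/
theorem pow_eq_one_iff_dvd (hP : P.under A = p) {s : A} (hs : ordAt p s = 1) {e : ℕ}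
    (he : ordAt P (algebraMap A B s) = e) {χ : G →* kˣ} {z : B} (hz : z ∈ eigen A χ)
    (hz1 : ordAt P z = 1) (m : ℕ) : (∀ h ∈ P.inertia G, χ h ^ m = 1) ↔ e ∣ m := by
  constructor
  · intro hm
    obtain ⟨f, hf, hfP⟩ := exists_mem_eigen_notMem A hG P (η := χ ^ m) hm
    have hz0 : z ≠ 0 := ((ordAt_eq_one_iff P).mp hz1).1
    have hf0 : f ≠ 0 := fun h => hfP (h ▸ P.zero_mem)
    obtain ⟨a, b, ha, hb, e1⟩ := exists_smul_eq_smul (pow_mem_eigen hz m) hf (pow_ne_zero m hz0) hf0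
    have h1 := congrArg (ordAt P) e1
    rw [Algebra.smul_def, Algebra.smul_def, AddValuation.map_mul, AddValuation.map_mul,
      ordAt_algebraMap p P hP hs a, ordAt_algebraMap p P hP hs b, AddValuation.map_pow, hz1,
      (ordAt_eq_zero_iff P).mpr hfP, he] at h1
    obtain ⟨i, hi⟩ := ENat.ne_top_iff_exists.mp ((ordAt_eq_top_iff p).not.mpr ha)
    obtain ⟨j, hj⟩ := ENat.ne_top_iff_exists.mp ((ordAt_eq_top_iff p).not.mpr hb)
    rw [← hi, ← hj, nsmul_one, add_zero] at h1
    have h2 : i * e + m = j * e := by exact_mod_cast h1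
    exact (Nat.dvd_add_right (Dvd.intro_left i rfl)).mp (h2 ▸ Dvd.intro_left j rfl)
  · rintro ⟨c, rfl⟩ h hh
    have := apply_eq_pow_of_ordAt_eq P hz hz1
      (algebraMap_mem_eigen_one (k := k) (G := G) (B := B) s) he hh
    rw [pow_mul, ← this, MonoidHom.one_apply, one_pow]

/-- The eigenspaces contain elements of order less than the ramification index. -/
theorem exists_mem_eigen_ordAt_lt (hP : P.under A = p) {s : A} (hs : ordAt p s = 1) {e : ℕ}
    (he : ordAt P (algebraMap A B s) = e) {η : G →* kˣ} (hη : ∃ f ∈ eigen A η, (f : B) ≠ 0) :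
    ∃ f ∈ eigen A η, ∃ m < e, ordAt P (f : B) = m := by
  obtain ⟨f, hf, hf0⟩ := hη
  obtain ⟨n, hn⟩ := ENat.ne_top_iff_exists.mp ((ordAt_eq_top_iff P).not.mpr hf0)
  induction n using Nat.strong_induction_on generalizing f with
  | _ n ih =>
    by_cases hne : n < e
    · exact ⟨f, hf, n, hne, hn.symm⟩
    · have hs0 : s ≠ 0 := ((ordAt_eq_one_iff p).mp hs).1
      obtain ⟨t, ht, d, hd, e1⟩ := exists_mem_eigen_smul_eq p P hP hs0 hf
        (by rw [he, ← hn]; exact_mod_cast not_lt.mp hne)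
      have ht0 : t ≠ 0 := fun h => ht (h ▸ p.zero_mem)
      have hd0 : d ≠ 0 := by
        rintro rfl
        rw [smul_zero, Algebra.smul_def] at e1
        refine mul_ne_zero ?_ hf0 e1
        exact (map_ne_zero_iff _ (FaithfulSMul.algebraMap_injective A B)).mpr ht0
      obtain ⟨j, hj⟩ := ENat.ne_top_iff_exists.mp ((ordAt_eq_top_iff P).not.mpr hd0)
      have h1 := congrArg (ordAt P) e1
      rw [Algebra.smul_def, Algebra.smul_def, AddValuation.map_mul, AddValuation.map_mul,
        (ordAt_eq_zero_iff P).mpr (algebraMap_notMem p P hP ht), he, ← hn, ← hj, zero_add] at h1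
      have h2 : n = e + j := by exact_mod_cast h1
      have hepos : 0 < e := by
        rw [pos_iff_ne_zero]
        rintro rfl
        rw [Nat.cast_zero, ordAt_eq_zero_iff] at he
        exact he (show s ∈ P.under A from hP ▸ (one_le_ordAt_iff p).mp hs.ge)
      exact ih j (by omega) d hd hd0 hj

end Uniformizer

section Comparison

variable (k A B G : Type*) [Field k] [CommRing A] [CommRing B] [Algebra k A]
  [Algebra k B] [Algebra A B] [IsScalarTower k A B] [CommGroup G] [MulSemiringAction G B]
  [SMulCommClass G A B]

variable {A G} in
/-- Some prime `P` of `B` over `p` has inertia group `H`, and some `χ`-eigenfunction generates the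
maximal ideal of the local ring at `P`. Thus `H` acts on the conormal space at `P` through the
restriction of `χ`. -/
def HasInertiaAt (p : Ideal A) (H : Subgroup G) (χ : G →* kˣ) : Prop :=
  ∃ P : Ideal B, P.IsPrime ∧ P.under A = p ∧ P.inertia G = H ∧
    ∃ z ∈ eigen A χ, (z : B) ≠ 0 ∧ z ∈ P ∧ ∀ b ∈ P, ∃ s ∉ P, ∃ a, s * b = z * a

/-- Numerical behaviour of a valuation `ord` of `B` extending `e` times the valuation `w` of `A`,
with inertia group `H` acting on a uniformizer through `χ`. -/
structure TameOrder {k A B G : Type*} [Field k] [CommRing A] [CommRing B] [Algebra k A]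
    [Algebra k B] [Algebra A B] [IsScalarTower k A B] [CommGroup G] [MulSemiringAction G B]
    [SMulCommClass G A B] (w : A → ℕ) (H : Subgroup G) (χ : G →* kˣ) (ord : B → ℕ) (e : ℕ) :
    Prop where
  ord_mul : ∀ b c : B, b ≠ 0 → c ≠ 0 → ord (b * c) = ord b + ord c
  ord_algebraMap : ∀ a : A, a ≠ 0 → ord (algebraMap A B a) = w a * e
  pow_eq_one_iff : ∀ m : ℕ, (∀ h ∈ H, χ h ^ m = 1) ↔ e ∣ m
  apply_eq_pow : ∀ (η : G →* kˣ), ∀ f ∈ eigen A η, f ≠ 0 → ∀ h ∈ H, η h = χ h ^ ord f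
  exists_ord_lt : ∀ η : G →* kˣ, ∃ f ∈ eigen A η, (f : B) ≠ 0 ∧ ord f < e

variable {k A B G}

theorem HasInertiaAt.exists_tameOrder [IsDomain A] [IsDomain B] [FaithfulSMul A B] [Finite G]
    [IsNoetherianRing B] [IsIntegrallyClosed B] [IsAlgClosed k] (hG : (Nat.card G : k) ≠ 0)
    [Algebra.IsInvariant A B G] (hfaith : ∀ g : G, (∀ b : B, g • b = b) → g = 1) (p : Ideal A)
    [p.IsPrime] [IsDiscreteValuationRing (Localization.AtPrime p)] {H : Subgroup G}
    {χ : G →* kˣ} (h : HasInertiaAt k B p H χ) :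
    ∃ (ord : B → ℕ) (e : ℕ), TameOrder (fun a => (ordAt p a).toNat) H χ ord e := by
  have := Fintype.ofFinite G
  have := Fintype.ofFinite (G →* kˣ)
  rw [Nat.card_eq_fintype_card] at hG
  obtain ⟨P, hPp, hP, rfl, z, hz, hz1⟩ := h
  have : Algebra.IsIntegral A B := Algebra.IsInvariant.isIntegral A B G
  have := isDiscreteValuationRing_of_under_eq p P hP
  rw [← ordAt_eq_one_iff] at hz1
  obtain ⟨s, hs⟩ := exists_ordAt_eq_one p
  have hs0 : s ≠ 0 := ((ordAt_eq_one_iff p).mp hs).1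
  have hinj := FaithfulSMul.algebraMap_injective A B
  obtain ⟨e, he⟩ := ENat.ne_top_iff_exists.mp
    ((ordAt_eq_top_iff P).not.mpr ((map_ne_zero_iff _ hinj).mpr hs0))
  refine ⟨fun b => (ordAt P b).toNat, e, ?_, ?_, ?_, ?_, ?_⟩
  · intro b c hb hc
    rw [AddValuation.map_mul, ENat.toNat_add ((ordAt_eq_top_iff P).not.mpr hb)
      ((ordAt_eq_top_iff P).not.mpr hc)]
  · intro a ha
    rw [ordAt_algebraMap p P hP hs, ENat.toNat_mul, ← he, ENat.toNat_natCast]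
  · exact pow_eq_one_iff_dvd hG p P hP hs he.symm hz hz1
  · intro η f hf hf0 h hh
    exact apply_eq_pow_of_ordAt_eq P hz hz1 hf
      (ENat.natCast_toNat ((ordAt_eq_top_iff P).not.mpr hf0)).symm hh
  · intro η
    obtain ⟨f, hf, m, hm, hfm⟩ := exists_mem_eigen_ordAt_lt p P hP hs he.symm
      (exists_ne_zero_mem_eigen hG hfaith η)
    refine ⟨f, hf, fun h0 => ?_, ?_⟩
    · rw [(ordAt_eq_top_iff P).mpr h0] at hfm
      exact ENat.natCast_ne_top m hfm.symm
    · rw [hfm, ENat.toNat_natCast]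
      exact hm

variable {B' : Type*} [CommRing B'] [Algebra k B'] [Algebra A B'] [IsScalarTower k A B']
  [MulSemiringAction G B'] [SMulCommClass G A B'] [IsDomain A] [IsDomain B] [IsDomain B']
  [FaithfulSMul A B] [FaithfulSMul A B']

/-- The orders of nonzero eigenfunctions are preserved by isomorphisms of eigenspaces: on both sides
the least order in the `η`-eigenspace is the unique `r < e` for which `η = χ ^ r` on the inertia
group. -/
theorem TameOrder.ord_map_eq [Finite G] [Algebra.IsInvariant A B G] [Finite (G →* kˣ)]
    {w : A → ℕ} {H : Subgroup G} {χ χ' : G →* kˣ}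
    (hχ : ∀ h ∈ H, χ h = χ' h) {ord : B → ℕ} {ord' : B' → ℕ} {e e' : ℕ}
    (T : TameOrder w H χ ord e) (T' : TameOrder w H χ' ord' e') {η : G →* kˣ}
    (φ : eigen (B := B) A η ≃ₗ[A] eigen (B := B') A η) (f : eigen (B := B) A η) (hf : f ≠ 0) :
    ord' (φ f : B') = ord (f : B) := by
  have hee : e = e' := by
    refine Nat.dvd_antisymm ((T.pow_eq_one_iff e').mp fun h hh => ?_)
      ((T'.pow_eq_one_iff e).mp fun h hh => ?_)
    · rw [hχ h hh]; exact (T'.pow_eq_one_iff e').mpr dvd_rfl h hh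
    · rw [← hχ h hh]; exact (T.pow_eq_one_iff e).mpr dvd_rfl h hh
  subst hee
  have hmod (m n : ℕ) (hmn : ∀ h ∈ H, χ h ^ m = χ h ^ n) : m ≡ n [MOD e] := by
    wlog hle : m ≤ n generalizing m n
    · exact (this n m (fun h hh => (hmn h hh).symm) (le_of_not_ge hle)).symm
    rw [Nat.modEq_iff_dvd' hle, ← T.pow_eq_one_iff]
    intro h hh
    rw [← mul_right_inj (χ h ^ m), ← pow_add, Nat.add_sub_cancel' hle, mul_one, hmn h hh]
  have hinj := FaithfulSMul.algebraMap_injective A B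
  have hinj' := FaithfulSMul.algebraMap_injective A B'
  -- the difference of the orders of `φ f` and `f` does not depend on `f`
  have hconst (f g : eigen (B := B) A η) (hf : f ≠ 0) (hg : g ≠ 0) :
      ord' (φ f : B') + ord (g : B) = ord' (φ g : B') + ord (f : B) := by
    have hf0 : (f : B) ≠ 0 := fun h => hf (Subtype.ext h)
    have hg0 : (g : B) ≠ 0 := fun h => hg (Subtype.ext h)
    have hf0' : (φ f : B') ≠ 0 := fun h => hf (φ.map_eq_zero_iff.mp (Subtype.ext h))
    have hg0' : (φ g : B') ≠ 0 := fun h => hg (φ.map_eq_zero_iff.mp (Subtype.ext h))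
    obtain ⟨a, b, ha, hb, e1⟩ := exists_smul_eq_smul f.2 g.2 hf0 hg0
    have e2 : a • f = b • g := Subtype.ext e1
    have e3 : a • (φ f : B') = b • (φ g : B') := by
      have := congrArg (fun x => (φ x : B')) e2
      simpa using this
    have h1 := congrArg ord e1
    have h2 := congrArg ord' e3
    rw [Algebra.smul_def, Algebra.smul_def, T.ord_mul _ _ ((map_ne_zero_iff _ hinj).mpr ha) hf0,
      T.ord_mul _ _ ((map_ne_zero_iff _ hinj).mpr hb) hg0, T.ord_algebraMap a ha,
      T.ord_algebraMap b hb] at h1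
    rw [Algebra.smul_def, Algebra.smul_def, T'.ord_mul _ _ ((map_ne_zero_iff _ hinj').mpr ha) hf0',
      T'.ord_mul _ _ ((map_ne_zero_iff _ hinj').mpr hb) hg0', T'.ord_algebraMap a ha,
      T'.ord_algebraMap b hb] at h2
    omega
  obtain ⟨g, hg, hg0, hge⟩ := T.exists_ord_lt η
  obtain ⟨g', hg', hg0', hge'⟩ := T'.exists_ord_lt η
  have hcg : ord g ≡ ord' g' [MOD e] := hmod _ _ fun h hh => by
    rw [← T.apply_eq_pow η g hg hg0 h hh, T'.apply_eq_pow η g' hg' hg0' h hh, hχ h hh]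
  have hgg : ord g = ord' g' := Nat.ModEq.eq_of_lt_of_lt hcg hge hge'
  -- the least order is attained at `g` and at `g'`
  have hmin (x : eigen (B := B) A η) (hx : x ≠ 0) : ord g ≤ ord (x : B) := by
    have hx0 : (x : B) ≠ 0 := fun h => hx (Subtype.ext h)
    have : ord g ≡ ord (x : B) [MOD e] := hmod _ _ fun h hh => by
      rw [← T.apply_eq_pow η g hg hg0 h hh, T.apply_eq_pow η x x.2 hx0 h hh]
    rw [← Nat.mod_eq_of_lt hge, this]
    exact Nat.mod_le _ _
  have hmin' (x : eigen (B := B') A η) (hx : x ≠ 0) : ord' g' ≤ ord' (x : B') := by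
    have hx0 : (x : B') ≠ 0 := fun h => hx (Subtype.ext h)
    have : ord' g' ≡ ord' (x : B') [MOD e] := hmod _ _ fun h hh => by
      rw [hχ h hh, ← T'.apply_eq_pow η g' hg' hg0' h hh, T'.apply_eq_pow η x x.2 hx0 h hh]
    rw [← Nat.mod_eq_of_lt hge', this]
    exact Nat.mod_le _ _
  have hgne : (⟨g, hg⟩ : eigen (B := B) A η) ≠ 0 := fun h => hg0 (congrArg Subtype.val h)
  have hgne' : (⟨g', hg'⟩ : eigen (B := B') A η) ≠ 0 := fun h => hg0' (congrArg Subtype.val h)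
  have hsne : φ.symm ⟨g', hg'⟩ ≠ 0 := fun h => hgne' (φ.symm.map_eq_zero_iff.mp h)
  have h1 := hconst _ f hgne hf
  have h2 := hconst _ f hsne hf
  have h3 := hmin _ hsne
  have h4 := hmin' _ (fun h => hgne (φ.map_eq_zero_iff.mp h))
  rw [LinearEquiv.apply_symm_apply] at h2
  simp only at h1 h2
  omega

/-- Isomorphisms of the eigenspaces of two normal extensions with the same inertia data are
multiplicative up to units of the base. -/
theorem exists_unit_mul_map_eq [Finite G] [IsAlgClosed k] [IsNoetherianRing A]
    [IsIntegrallyClosed A]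
    [IsNoetherianRing B] [IsIntegrallyClosed B] [IsNoetherianRing B'] [IsIntegrallyClosed B']
    (hG : (Nat.card G : k) ≠ 0) [Algebra.IsInvariant A B G] [Algebra.IsInvariant A B' G]
    (hfaith : ∀ g : G, (∀ b : B, g • b = b) → g = 1)
    (hfaith' : ∀ g : G, (∀ b : B', g • b = b) → g = 1)
    (hdata : ∀ (p : Ideal A) [p.IsPrime], IsDiscreteValuationRing (Localization.AtPrime p) →
      ∃ (H : Subgroup G) (χ χ' : G →* kˣ), HasInertiaAt k B p H χ ∧ HasInertiaAt k B' p H χ' ∧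
        ∀ h ∈ H, χ h = χ' h)
    (φ : ∀ η : G →* kˣ, eigen (B := B) A η ≃ₗ[A] eigen (B := B') A η) (α β : G →* kˣ) :
    ∃ c : Aˣ, ∀ (f : eigen (B := B) A α) (g : eigen (B := B) A β),
      (φ α f : B') * φ β g = (c : A) • (φ (α * β) ⟨f * g, mul_mem_eigen f.2 g.2⟩ : B') := by
  have : Fintype G := Fintype.ofFinite G
  have : Fintype (G →* kˣ) := Fintype.ofFinite _
  have hinj := FaithfulSMul.algebraMap_injective A B
  have hinj' := FaithfulSMul.algebraMap_injective A B'
  have hG' : (Fintype.card G : k) ≠ 0 := by rwa [← Nat.card_eq_fintype_card]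
  obtain ⟨f, hf, hf0⟩ := exists_ne_zero_mem_eigen (A := A) (B := B) hG' hfaith α
  obtain ⟨g, hg, hg0⟩ := exists_ne_zero_mem_eigen (A := A) (B := B) hG' hfaith β
  have hne {η : G →* kˣ} {x : eigen (B := B) A η} (hx : (x : B) ≠ 0) : (φ η x : B') ≠ 0 :=
    fun h => hx (congrArg Subtype.val ((φ η).map_eq_zero_iff.mp (Subtype.ext h)))
  let x : B' := (φ α ⟨f, hf⟩).1
  let y : B' := (φ β ⟨g, hg⟩).1
  let z : B' := (φ (α * β) ⟨f * g, mul_mem_eigen hf hg⟩).1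
  have hx0 : x ≠ 0 := hne hf0
  have hy0 : y ≠ 0 := hne hg0
  have hz0 : z ≠ 0 := hne (mul_ne_zero hf0 hg0)
  obtain ⟨a, b, ha, hb, e1⟩ := exists_smul_eq_smul (A := A)
    (mul_mem_eigen (φ α ⟨f, hf⟩).2 (φ β ⟨g, hg⟩).2)
    (φ (α * β) ⟨f * g, mul_mem_eigen hf hg⟩).2 (mul_ne_zero hx0 hy0) hz0
  have hord (p : Ideal A) [p.IsPrime] [IsDiscreteValuationRing (Localization.AtPrime p)] :
      ordAt p a = ordAt p b := by
    obtain ⟨H, χ, χ', h, h', hχ⟩ := hdata p inferInstance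
    obtain ⟨ord, e, T⟩ := h.exists_tameOrder hG hfaith p
    obtain ⟨ord', e', T'⟩ := h'.exists_tameOrder hG hfaith' p
    have h1 := congrArg ord' e1
    rw [Algebra.smul_def, Algebra.smul_def,
      T'.ord_mul _ _ ((map_ne_zero_iff _ hinj').mpr ha) (mul_ne_zero hx0 hy0),
      T'.ord_mul _ _ ((map_ne_zero_iff _ hinj').mpr hb) hz0, T'.ord_mul _ _ hx0 hy0,
      T'.ord_algebraMap a ha, T'.ord_algebraMap b hb,
      T.ord_map_eq hχ T' (φ α) ⟨f, hf⟩ (fun h => hf0 (congrArg Subtype.val h)),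
      T.ord_map_eq hχ T' (φ β) ⟨g, hg⟩ (fun h => hg0 (congrArg Subtype.val h)),
      T.ord_map_eq hχ T' (φ (α * β)) ⟨f * g, _⟩
        (fun h => mul_ne_zero hf0 hg0 (congrArg Subtype.val h)),
      T.ord_mul f g hf0 hg0, add_left_inj] at h1
    have he : 0 < e' := by
      obtain ⟨_, _, _, h⟩ := T'.exists_ord_lt 1
      omega
    have h2 := Nat.eq_of_mul_eq_mul_right he h1
    rw [← ENat.natCast_toNat ((ordAt_eq_top_iff p).not.mpr ha), h2,
      ENat.natCast_toNat ((ordAt_eq_top_iff p).not.mpr hb)]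
  have hab : a ∣ b := dvd_of_forall_prime ha fun p _ _ => by
    obtain ⟨s, hs, d, e⟩ := exists_of_ordAt_le p (hord p).le
    exact ⟨s, hs, d, e⟩
  have hba : b ∣ a := dvd_of_forall_prime hb fun p _ _ => by
    obtain ⟨s, hs, d, e⟩ := exists_of_ordAt_le p (hord p).ge
    exact ⟨s, hs, d, e⟩
  obtain ⟨c, rfl⟩ := associated_of_dvd_dvd hab hba
  have e2 : x * y = (c : A) • z := by
    rw [mul_smul] at e1
    rw [Algebra.smul_def, Algebra.smul_def a (_ • z)] at e1
    exact mul_left_cancel₀ ((map_ne_zero_iff _ hinj').mpr ha) e1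
  refine ⟨c, fun f₁ g₁ => ?_⟩
  by_cases hf1 : (f₁ : B) = 0
  · have : f₁ = 0 := Subtype.ext hf1
    subst this
    have h0 : (⟨((0 : eigen (B := B) A α) : B) * g₁, mul_mem_eigen (Submodule.zero_mem _) g₁.2⟩ :
      eigen (B := B) A (α * β)) = 0 := Subtype.ext (zero_mul _)
    rw [h0]; simp
  by_cases hg1 : (g₁ : B) = 0
  · have : g₁ = 0 := Subtype.ext hg1
    subst this
    have h0 : (⟨f₁ * ((0 : eigen (B := B) A β) : B), mul_mem_eigen f₁.2 (Submodule.zero_mem _)⟩ :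
      eigen (B := B) A (α * β)) = 0 := Subtype.ext (mul_zero _)
    rw [h0]; simp
  obtain ⟨a₁, a₂, ha1, ha2, h1⟩ := exists_smul_eq_smul f₁.2 hf hf1 hf0
  obtain ⟨b₁, b₂, hb1, hb2, h2⟩ := exists_smul_eq_smul g₁.2 hg hg1 hg0
  have hφ {η : G →* kˣ} (r t : A) (u v : eigen (B := B) A η) (h : r • (u : B) = t • (v : B)) :
      r • (φ η u : B') = t • (φ η v : B') := by
    have := congrArg (φ η) (Subtype.ext h : r • u = t • v)
    rw [map_smul, map_smul] at this
    exact congrArg Subtype.val this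
  have h1' : a₁ • (φ α f₁ : B') = a₂ • x := hφ _ _ _ ⟨f, hf⟩ h1
  have h2' : b₁ • (φ β g₁ : B') = b₂ • y := hφ _ _ _ ⟨g, hg⟩ h2
  have h3' : (a₁ * b₁) • (φ (α * β) ⟨f₁ * g₁, mul_mem_eigen f₁.2 g₁.2⟩ : B') = (a₂ * b₂) • z :=
    hφ _ _ ⟨f₁ * g₁, _⟩ ⟨f * g, mul_mem_eigen hf hg⟩ (by
      simp only [← smul_mul_smul_comm, h1, h2])
  have hab0 : algebraMap A B' (a₁ * b₁) ≠ 0 :=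
    (map_ne_zero_iff _ hinj').mpr (mul_ne_zero ha1 hb1)
  refine mul_left_cancel₀ hab0 ?_
  rw [← Algebra.smul_def, ← Algebra.smul_def, ← smul_mul_smul_comm, h1', h2', smul_mul_smul_comm,
    e2, smul_comm, ← h3', smul_comm]

end Comparison

/-! ### Trivializing the cocycle over an étale extension -/

section TwistedIso

open scoped TensorProduct

/-- A cocycle becomes trivial over the twisted group algebra, which is an étale cover. -/
theorem SymmCocycle.exists_etale {A : Type u} [CommRing A] [IsNoetherianRing A] {Γ : Type*}
    [CommGroup Γ] [Finite Γ] (hΓ : IsUnit (Nat.card Γ : A)) (c : SymmCocycle Γ A) :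
    ∃ (A₁ : Type u) (_ : CommRing A₁) (_ : Algebra A A₁), Algebra.Etale A A₁ ∧
      Function.Surjective (PrimeSpectrum.comap (algebraMap A A₁)) ∧
      ∃ e : Γ → A₁ˣ, e 1 = 1 ∧
        ∀ α β, (e α : A₁) * e β = algebraMap A A₁ (c.val α β) * (e (α * β) : A₁) := by
  classical
  have := Fintype.ofFinite Γ
  rw [Nat.card_eq_fintype_card] at hΓ
  have : Small.{u} (TwistedAlgebra c) := inferInstanceAs (Small.{u} (Γ → A))
  let E : Shrink.{u} (TwistedAlgebra c) ≃ₐ[A] TwistedAlgebra c := Shrink.algEquiv A _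
  have h1 := TwistedAlgebra.etale c hΓ
  have h2 : Algebra.IsIntegral A (Shrink.{u} (TwistedAlgebra c)) :=
    have : Module.Finite A (Shrink.{u} (TwistedAlgebra c)) := Module.Finite.equiv E.symm.toLinearEquiv
    inferInstance
  refine ⟨Shrink.{u} (TwistedAlgebra c), inferInstance, inferInstance,
    Algebra.Etale.of_equiv E.symm, ?_, fun γ => Units.map E.symm (TwistedAlgebra.isUnit_single c γ).unit,
    ?_, fun α β => ?_⟩
  · have : FaithfulSMul A (Shrink.{u} (TwistedAlgebra c)) :=
      (faithfulSMul_iff_algebraMap_injective _ _).mpr ?_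
    · exact Algebra.IsIntegral.comap_surjective A _
    intro a b hab
    exact TwistedAlgebra.algebraMap_injective c (by
      simpa only [AlgEquiv.commutes] using congrArg E hab)
  · refine Units.ext ?_
    simp [← TwistedAlgebra.one_def]
  · simp only [Units.coe_map, IsUnit.unit_spec, MonoidHom.coe_coe]
    rw [← map_mul, TwistedAlgebra.single_mul_single, map_smul, Algebra.smul_def]

variable {k A B B' G : Type*} [Field k] [CommRing A] [CommRing B] [Algebra k A]
  [Algebra k B] [Algebra A B] [IsScalarTower k A B] [CommGroup G] [MulSemiringAction G B]
  [SMulCommClass G A B] [CommRing B'] [Algebra k B'] [Algebra A B'] [IsScalarTower k A B']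
  [MulSemiringAction G B'] [SMulCommClass G A B'] [Fintype G]

/-- A linear map of eigenspaces, extended by zero to the other eigenspaces. -/
def extendEigen {η : G →* kˣ} (φ : eigen (B := B) A η →ₗ[A] eigen (B := B') A η) : B →ₗ[A] B' :=
  (eigen A η).subtype ∘ₗ φ ∘ₗ (eigenProj A η).codRestrict (eigen A η) (eigenProj_mem η)

section

variable (hG : (Fintype.card G : k) ≠ 0)
include hG

theorem extendEigen_of_mem {η : G →* kˣ} (φ : eigen (B := B) A η →ₗ[A] eigen (B := B') A η)
    {f : B} (hf : f ∈ eigen A η) : extendEigen φ f = φ ⟨f, hf⟩ := by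
  have : (⟨eigenProj A η f, eigenProj_mem η f⟩ : eigen (B := B) A η) = ⟨f, hf⟩ :=
    Subtype.ext (eigenProj_of_mem hG hf)
  exact congrArg (fun x => (φ x : B')) this

omit hG in
theorem extendEigen_of_ne {η χ : G →* kˣ} (hne : η ≠ χ)
    (φ : eigen (B := B) A η →ₗ[A] eigen (B := B') A η)
    {f : B} (hf : f ∈ eigen A χ) : extendEigen φ f = 0 := by
  have : (⟨eigenProj A η f, eigenProj_mem η f⟩ : eigen (B := B) A η) = 0 :=
    Subtype.ext (eigenProj_of_mem_of_ne hne hf)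
  exact (congrArg (fun x => (φ x : B')) this).trans (by simp)

variable [IsAlgClosed k] [Fintype (G →* kˣ)]

theorem eigen_induction {motive : B → Prop} (h0 : motive 0)
    (hadd : ∀ a b, motive a → motive b → motive (a + b))
    (h : ∀ (χ : G →* kˣ), ∀ f ∈ eigen A χ, motive f) (b : B) : motive b := by
  rw [← sum_eigenProj (A := A) hG b]
  exact Finset.sum_induction _ motive hadd h0 fun χ _ => h χ _ (eigenProj_mem χ b)

variable {A₁ : Type*} [CommRing A₁] [Algebra A A₁]

/-- The map `b ↦ ∑ e η ⊗ φ η b`. -/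
def twistMap (e : (G →* kˣ) → A₁)
    (φ : ∀ η : G →* kˣ, eigen (B := B) A η →ₗ[A] eigen (B := B') A η) : B →ₗ[A] A₁ ⊗[A] B' :=
  ∑ η, TensorProduct.mk A A₁ B' (e η) ∘ₗ extendEigen (φ η)

theorem twistMap_of_mem (e : (G →* kˣ) → A₁)
    (φ : ∀ η : G →* kˣ, eigen (B := B) A η →ₗ[A] eigen (B := B') A η) {χ : G →* kˣ} {f : B}
    (hf : f ∈ eigen A χ) : twistMap e φ f = e χ ⊗ₜ (φ χ ⟨f, hf⟩ : B') := by
  rw [twistMap, LinearMap.sum_apply, Finset.sum_eq_single χ]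
  · rw [LinearMap.comp_apply, TensorProduct.mk_apply, extendEigen_of_mem hG]
  · intro η _ hne
    rw [LinearMap.comp_apply, extendEigen_of_ne hne _ hf, map_zero]
  · simp

theorem liftBaseChange_twistMap_twistMap {e e' : (G →* kˣ) → A₁} (he : ∀ η, e' η * e η = 1)
    (φ : ∀ η : G →* kˣ, eigen (B := B) A η →ₗ[A] eigen (B := B') A η)
    (φ' : ∀ η : G →* kˣ, eigen (B := B') A η →ₗ[A] eigen (B := B) A η)
    (hφ : ∀ η f, φ η (φ' η f) = f) (x : A₁ ⊗[A] B') :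
    (twistMap e φ).liftBaseChange A₁ ((twistMap e' φ').liftBaseChange A₁ x) = x := by
  induction x using TensorProduct.induction_on with
  | zero => simp
  | add x y hx hy => rw [map_add, map_add, hx, hy]
  | tmul a b =>
    refine eigen_induction (A := A) hG
      (motive := fun b => (twistMap e φ).liftBaseChange A₁ ((twistMap e' φ').liftBaseChange A₁
        (a ⊗ₜ[A] b)) = a ⊗ₜ b) (by simp) (fun b c hb hc => ?_) (fun χ f hf => ?_) b
    · rw [TensorProduct.tmul_add, map_add, map_add, hb, hc]
    · rw [LinearMap.liftBaseChange_tmul, twistMap_of_mem hG e' φ' hf, TensorProduct.smul_tmul',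
        LinearMap.liftBaseChange_tmul, twistMap_of_mem hG e φ (φ' χ _).2, TensorProduct.smul_tmul',
        Subtype.coe_eta, hφ, smul_eq_mul, smul_eq_mul, mul_assoc, he, mul_one]

/-- If the `φ η` are multiplicative up to a cocycle which the units `e` trivialize, then
`b ↦ ∑ e η ⊗ φ η b` is multiplicative. -/
def twistAlgHom {e : (G →* kˣ) → A₁} {c : (G →* kˣ) → (G →* kˣ) → A}
    (φ : ∀ η : G →* kˣ, eigen (B := B) A η →ₗ[A] eigen (B := B') A η)
    (he1 : e 1 = 1)
    (he : ∀ α β, algebraMap A A₁ (c α β) * (e α * e β) = e (α * β))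
    (hφ1 : extendEigen (φ 1) 1 = 1)
    (hφ : ∀ α β, ∀ f ∈ eigen A α, ∀ g ∈ eigen A β,
      extendEigen (φ α) f * extendEigen (φ β) g = c α β • extendEigen (φ (α * β)) (f * g)) :
    B →ₐ[A] A₁ ⊗[A] B' :=
  AlgHom.ofLinearMap (twistMap e φ)
    (by
      have h1 : (1 : B) ∈ eigen A (1 : G →* kˣ) := by
        simpa using algebraMap_mem_eigen_one (k := k) (G := G) (B := B) (1 : A)
      rw [twistMap_of_mem hG e φ h1, ← extendEigen_of_mem hG (φ 1) h1, hφ1, he1]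
      rfl)
    (fun a b => by
      refine eigen_induction (A := A) hG
        (motive := fun a => twistMap e φ (a * b) = twistMap e φ a * twistMap e φ b)
        (by simp) (fun a a' h h' => by rw [add_mul, map_add, map_add, h, h', add_mul])
        (fun α f hf => ?_) a
      refine eigen_induction (A := A) hG
        (motive := fun b => twistMap e φ (f * b) = twistMap e φ f * twistMap e φ b)
        (by simp) (fun a a' h h' => by rw [mul_add, map_add, map_add, h, h', mul_add])
        (fun β g hg => ?_) b
      rw [twistMap_of_mem hG e φ hf, twistMap_of_mem hG e φ hg,
        twistMap_of_mem hG e φ (mul_mem_eigen hf hg), ← extendEigen_of_mem hG (φ α) hf,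
        ← extendEigen_of_mem hG (φ β) hg, ← extendEigen_of_mem hG (φ (α * β)) (mul_mem_eigen hf hg),
        Algebra.TensorProduct.tmul_mul_tmul, hφ α β f hf g hg, TensorProduct.tmul_smul,
        ← he α β, ← Algebra.smul_def, TensorProduct.smul_tmul'])

theorem twistMap_smul (e : (G →* kˣ) → A₁)
    (φ : ∀ η : G →* kˣ, eigen (B := B) A η →ₗ[A] eigen (B := B') A η) (g : G) (b : B) :
    twistMap e φ (g • b) = Algebra.TensorProduct.map (AlgHom.id A A₁)
      (MulSemiringAction.toAlgHom A B' g) (twistMap e φ b) := by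
  refine eigen_induction (A := A) hG
    (motive := fun b => twistMap e φ (g • b) = Algebra.TensorProduct.map (AlgHom.id A A₁)
      (MulSemiringAction.toAlgHom A B' g) (twistMap e φ b)) (by simp)
      (fun a a' h h' => by rw [smul_add, map_add, map_add, map_add, h, h'])
      (fun α f hf => ?_) b
  rw [hf g, ← algebraMap_smul A, map_smul, twistMap_of_mem hG e φ hf,
    Algebra.TensorProduct.map_tmul, MulSemiringAction.toAlgHom_apply, (φ α ⟨f, hf⟩).2 g,
    ← algebraMap_smul A (α g : k) (φ α ⟨f, hf⟩ : B'), TensorProduct.tmul_smul, AlgHom.id_apply]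

end

/-- Two normal extensions of `A` with the same inertia data and isomorphic eigenspaces become
equivariantly isomorphic over an étale cover. -/
theorem exists_etale_algEquiv {k : Type*} {A B B' : Type u} {G : Type*} [Field k] [IsAlgClosed k]
    [CommRing A] [CommRing B] [CommRing B'] [Algebra k A] [Algebra k B] [Algebra k B']
    [Algebra A B] [Algebra A B'] [IsScalarTower k A B] [IsScalarTower k A B'] [CommGroup G]
    [Finite G] [MulSemiringAction G B] [MulSemiringAction G B'] [SMulCommClass G A B]
    [SMulCommClass G A B'] [IsDomain A] [IsDomain B] [IsDomain B'] [FaithfulSMul A B]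
    [FaithfulSMul A B'] [IsNoetherianRing A] [IsIntegrallyClosed A] [IsNoetherianRing B]
    [IsIntegrallyClosed B] [IsNoetherianRing B'] [IsIntegrallyClosed B']
    (hG : (Nat.card G : k) ≠ 0) [Algebra.IsInvariant A B G] [Algebra.IsInvariant A B' G]
    (hfaith : ∀ g : G, (∀ b : B, g • b = b) → g = 1)
    (hfaith' : ∀ g : G, (∀ b : B', g • b = b) → g = 1)
    (hdata : ∀ (p : Ideal A) [p.IsPrime], IsDiscreteValuationRing (Localization.AtPrime p) →
      ∃ (H : Subgroup G) (χ χ' : G →* kˣ), HasInertiaAt k B p H χ ∧ HasInertiaAt k B' p H χ' ∧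
        ∀ h ∈ H, χ h = χ' h)
    (φ : ∀ η : G →* kˣ, eigen (B := B) A η ≃ₗ[A] eigen (B := B') A η) :
    ∃ (A₁ : Type u) (_ : CommRing A₁) (_ : Algebra A A₁), Algebra.Etale A A₁ ∧
      Function.Surjective (PrimeSpectrum.comap (algebraMap A A₁)) ∧
      ∃ Θ : A₁ ⊗[A] B ≃ₐ[A₁] A₁ ⊗[A] B', ∀ (g : G) (b : B), Θ (1 ⊗ₜ (g • b)) =
        Algebra.TensorProduct.map (AlgHom.id A A₁) (MulSemiringAction.toAlgHom A B' g)
          (Θ (1 ⊗ₜ b)) := by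
  have : Fintype G := Fintype.ofFinite G
  have : Fintype (G →* kˣ) := Fintype.ofFinite _
  have hG' : (Fintype.card G : k) ≠ 0 := by rwa [← Nat.card_eq_fintype_card]
  have hinj' := FaithfulSMul.algebraMap_injective A B'
  choose c hc using exists_unit_mul_map_eq hG hfaith hfaith' hdata φ
  have h1B : (1 : B) ∈ eigen A (1 : G →* kˣ) := by
    simpa using algebraMap_mem_eigen_one (k := k) (G := G) (B := B) (1 : A)
  have hmem (η : G →* kˣ) : ∃ f ∈ eigen A η, (f : B) ≠ 0 := exists_ne_zero_mem_eigen hG' hfaith η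
  let Φ (η : G →* kˣ) : B →ₗ[A] B' := extendEigen (φ η).toLinearMap
  have hΦ0 (η : G →* kˣ) (f : B) (hf : f ∈ eigen A η) (hf0 : f ≠ 0) : Φ η f ≠ 0 := by
    intro h
    rw [show Φ η f = φ η ⟨f, hf⟩ from extendEigen_of_mem hG' _ hf] at h
    exact hf0 (congrArg Subtype.val ((φ η).map_eq_zero_iff.mp (Subtype.ext h)))
  have hΦ (α β : G →* kˣ) (f : B) (hf : f ∈ eigen A α) (g : B) (hg : g ∈ eigen A β) :
      Φ α f * Φ β g = (c α β : A) • Φ (α * β) (f * g) := by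
    rw [show Φ α f = φ α ⟨f, hf⟩ from extendEigen_of_mem hG' _ hf,
      show Φ β g = φ β ⟨g, hg⟩ from extendEigen_of_mem hG' _ hg,
      show Φ (α * β) (f * g) = φ (α * β) ⟨f * g, _⟩ from
        extendEigen_of_mem hG' _ (mul_mem_eigen hf hg)]
    exact hc α β ⟨f, hf⟩ ⟨g, hg⟩
  have hcancel (a b : Aˣ) (x : B') (hx : x ≠ 0) (h : (a : A) • x = (b : A) • x) : a = b := by
    rw [Algebra.smul_def, Algebra.smul_def] at h
    exact Units.ext (hinj' (mul_right_cancel₀ hx h))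
  have hsymm (α β : G →* kˣ) : c α β = c β α := by
    obtain ⟨f, hf, hf0⟩ := hmem α
    obtain ⟨g, hg, hg0⟩ := hmem β
    refine hcancel _ _ _ (hΦ0 (α * β) (f * g) (mul_mem_eigen hf hg) (mul_ne_zero hf0 hg0)) ?_
    rw [← hΦ α β f hf g hg, mul_comm α β, mul_comm f g, ← hΦ β α g hg f hf, mul_comm]
  have hcoc (α β γ : G →* kˣ) : c α β * c (α * β) γ = c β γ * c α (β * γ) := by
    obtain ⟨f, hf, hf0⟩ := hmem α
    obtain ⟨g, hg, hg0⟩ := hmem β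
    obtain ⟨h, hh, hh0⟩ := hmem γ
    refine hcancel _ _ _ (hΦ0 (α * β * γ) (f * g * h) (mul_mem_eigen (mul_mem_eigen hf hg) hh)
      (mul_ne_zero (mul_ne_zero hf0 hg0) hh0)) ?_
    rw [Units.val_mul, Units.val_mul, mul_smul, mul_smul,
      ← hΦ (α * β) γ (f * g) (mul_mem_eigen hf hg) h hh, mul_assoc α β γ, mul_assoc f g h,
      ← hΦ α (β * γ) f hf (g * h) (mul_mem_eigen hg hh), ← smul_mul_assoc, ← hΦ α β f hf g hg,
      ← mul_smul_comm, ← hΦ β γ g hg h hh, mul_assoc]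
  have hΦ1 : Φ 1 1 = algebraMap A B' (c 1 1) := by
    have h := hΦ 1 1 1 h1B 1 h1B
    rw [mul_one, one_mul (1 : G →* kˣ), Algebra.smul_def] at h
    exact mul_right_cancel₀ (hΦ0 1 1 h1B one_ne_zero) h
  have hone (β : G →* kˣ) : c 1 β = c 1 1 := by
    obtain ⟨g, hg, hg0⟩ := hmem β
    have h := hΦ 1 β 1 h1B g hg
    rw [hΦ1, one_mul, one_mul β, ← Algebra.smul_def] at h
    exact (hcancel _ _ _ (hΦ0 β g hg hg0) h).symm
  -- rescaling all `φ η` by `(c 1 1)⁻¹` normalizes the cocycle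
  let d : SymmCocycle (G →* kˣ) A :=
    { val := fun α β => c 1 1 * (c α β)⁻¹
      symm := fun α β => by rw [hsymm α β]
      one_left := fun α => by rw [hone α, mul_inv_cancel]
      cocycle := fun α β γ => by
        have := hcoc α β γ
        rw [mul_mul_mul_comm, mul_mul_mul_comm _ _ _ (c α (β * γ))⁻¹, ← mul_inv, ← mul_inv, this] }
  have hΓ : IsUnit (Nat.card (G →* kˣ) : A) := by
    have := hasEnoughRootsOfUnity hG'
    rw [CommGroup.card_monoidHom_of_hasEnoughRootsOfUnity, ← map_natCast (algebraMap k A)]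
    exact (IsUnit.mk0 _ hG).map _
  obtain ⟨A₁, hA₁, hAA₁, het, hsurj, e, he1, he⟩ := d.exists_etale hΓ
  refine ⟨A₁, hA₁, hAA₁, het, hsurj, ?_⟩
  let ψ (η : G →* kˣ) : eigen (B := B) A η ≃ₗ[A] eigen (B := B') A η :=
    (φ η).trans (LinearEquiv.smulOfUnit (c 1 1)⁻¹)
  have hψ (η : G →* kˣ) (f : B) :
      extendEigen (ψ η).toLinearMap f = (((c 1 1)⁻¹ : Aˣ) : A) • Φ η f := rfl
  let τ : B →ₐ[A] A₁ ⊗[A] B' :=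
    twistAlgHom (e := fun η => (e η : A₁)) (c := fun α β => (((c 1 1)⁻¹ * c α β : Aˣ) : A)) hG'
      (fun η => (ψ η).toLinearMap) (by rw [he1, Units.val_one])
      (fun α β => by
        rw [he, ← mul_assoc, ← map_mul, ← Units.val_mul, mul_mul_mul_comm, inv_mul_cancel, one_mul,
          mul_inv_cancel, Units.val_one, map_one, one_mul])
      (by rw [hψ, hΦ1, Algebra.smul_def, ← map_mul, ← Units.val_mul, inv_mul_cancel, Units.val_one,
        map_one])
      (fun α β f hf g hg => by
        rw [hψ, hψ, hψ, smul_mul_smul_comm, hΦ α β f hf g hg, smul_smul, smul_smul, ← Units.val_mul,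
          ← Units.val_mul, ← Units.val_mul, mul_right_comm])
  have hτ (b : B) : τ b = twistMap (fun η => (e η : A₁)) (fun η => (ψ η).toLinearMap) b := rfl
  let Θ₀ : A₁ ⊗[A] B →ₐ[A₁] A₁ ⊗[A] B' := Algebra.TensorProduct.lift (Algebra.ofId A₁ _) τ
    fun _ _ => Commute.all _ _
  have hΘ₀ (x : A₁ ⊗[A] B) : Θ₀ x =
      (twistMap (fun η => (e η : A₁)) (fun η => (ψ η).toLinearMap)).liftBaseChange A₁ x := by
    induction x using TensorProduct.induction_on with
    | zero => simp
    | add x y hx hy => rw [map_add, map_add, hx, hy]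
    | tmul a b =>
      rw [LinearMap.liftBaseChange_tmul, Algebra.TensorProduct.lift_tmul, ← hτ, Algebra.ofId_apply,
        Algebra.smul_def]
  let Ψ := (twistMap (B := B') (B' := B) (fun η => ((e η)⁻¹ : A₁ˣ).1)
    (fun η => (ψ η).symm.toLinearMap)).liftBaseChange A₁
  have hbij : Function.Bijective Θ₀ := by
    refine Function.bijective_iff_has_inverse.mpr ⟨Ψ, fun x => ?_, fun x => ?_⟩
    · rw [hΘ₀]
      exact liftBaseChange_twistMap_twistMap hG' (fun η => by simp) _ _ (fun η f => by simp) x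
    · rw [hΘ₀]
      exact liftBaseChange_twistMap_twistMap hG' (fun η => by simp) _ _ (fun η f => by simp) x
  refine ⟨AlgEquiv.ofBijective Θ₀ hbij, fun g b => ?_⟩
  rw [AlgEquiv.ofBijective_apply, AlgEquiv.ofBijective_apply, hΘ₀, hΘ₀,
    LinearMap.liftBaseChange_one_tmul, LinearMap.liftBaseChange_one_tmul]
  exact twistMap_smul hG' _ _ g b

end TwistedIso

/-! ### Points and prime ideals -/

section VanishingIdeal

variable {X Y : Scheme.{u}}

/-- The prime ideal of the functions on the open set `U` that vanish at the point `x`. -/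
def vanishingIdeal (U : X.Opens) (x : X) (hx : x ∈ U) : Ideal Γ(X, U) :=
  (IsLocalRing.maximalIdeal (X.presheaf.stalk x)).comap (X.presheaf.germ U x hx).hom

instance vanishingIdeal_isPrime (U : X.Opens) (x : X) (hx : x ∈ U) : (vanishingIdeal U x hx).IsPrime :=
  Ideal.comap_isPrime _ _

theorem mem_vanishingIdeal {U : X.Opens} {x : X} {hx : x ∈ U} {f : Γ(X, U)} :
    f ∈ vanishingIdeal U x hx ↔
      X.presheaf.germ U x hx f ∈ IsLocalRing.maximalIdeal (X.presheaf.stalk x) := Iff.rfl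

theorem mem_vanishingIdeal_iff_notMem_basicOpen {U : X.Opens} {x : X} {hx : x ∈ U} {f : Γ(X, U)} :
    f ∈ vanishingIdeal U x hx ↔ x ∉ X.basicOpen f := by
  rw [X.mem_basicOpen f x hx, mem_vanishingIdeal, IsLocalRing.mem_maximalIdeal, mem_nonunits_iff]

theorem vanishingIdeal_le_of_specializes {U : X.Opens} {x x' : X} (hx : x ∈ U) (hx' : x' ∈ U)
    (h : x ⤳ x') : vanishingIdeal U x hx ≤ vanishingIdeal U x' hx' := fun f hf => by
  rw [mem_vanishingIdeal_iff_notMem_basicOpen] at hf ⊢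
  exact fun hm => hf (h.mem_open (X.basicOpen f).2 hm)

theorem specializes_of_vanishingIdeal_le {U : X.Opens} (hU : IsAffineOpen U) {x x' : X}
    (hx : x ∈ U) (hx' : x' ∈ U) (h : vanishingIdeal U x hx ≤ vanishingIdeal U x' hx') : x ⤳ x' := by
  rw [specializes_iff_forall_open]
  intro s hs hxs
  obtain ⟨f, hfs, hf⟩ := hU.exists_basicOpen_le (V := ⟨s, hs⟩) ⟨x', hxs⟩ hx'
  by_contra hn
  refine mem_vanishingIdeal_iff_notMem_basicOpen.mp
    (h (mem_vanishingIdeal_iff_notMem_basicOpen.mpr fun hm => hn (hfs hm))) hf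

theorem comap_vanishingIdeal (f : X ⟶ Y) {U : Y.Opens} {W : X.Opens} (e : W ≤ f ⁻¹ᵁ U) (x : X)
    (hx : x ∈ W) :
    (vanishingIdeal W x hx).comap (f.appLE U W e).hom =
      vanishingIdeal U (f x) (show f x ∈ U from e hx) := by
  ext a
  rw [Ideal.mem_comap, mem_vanishingIdeal_iff_notMem_basicOpen,
    mem_vanishingIdeal_iff_notMem_basicOpen, not_iff_not, Scheme.basicOpen_appLE]
  exact ⟨fun h => h.2, fun h => ⟨hx, h⟩⟩

theorem primeIdealOf_asIdeal {U : X.Opens} (hU : IsAffineOpen U) (x : X) (hx : x ∈ U) :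
    (hU.primeIdealOf ⟨x, hx⟩).asIdeal = vanishingIdeal U x hx := by
  rw [hU.primeIdealOf_eq_map_closedPoint]
  rfl

theorem exists_vanishingIdeal_eq {U : X.Opens} (hU : IsAffineOpen U) (P : Ideal Γ(X, U))
    [hP : P.IsPrime] : ∃ (x : X) (hx : x ∈ U), vanishingIdeal U x hx = P := by
  let z : PrimeSpectrum Γ(X, U) := ⟨P, hP⟩
  obtain ⟨x, e⟩ : ∃ x : U, hU.primeIdealOf x = z := ⟨hU.isoSpec.inv z,
    hU.isoSpec.schemeIsoToHomeo.apply_symm_apply z⟩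
  exact ⟨x, x.2, by rw [← primeIdealOf_asIdeal hU, e]⟩

theorem isLocalization_stalk {U : X.Opens} (hU : IsAffineOpen U) (x : X) (hx : x ∈ U) :
    letI := (X.presheaf.germ U x hx).hom.toAlgebra
    IsLocalization.AtPrime (X.presheaf.stalk x) (vanishingIdeal U x hx) := by
  have := hU.isLocalization_stalk ⟨x, hx⟩
  simp only [primeIdealOf_asIdeal hU] at this
  exact this

/-- Sections over an affine open set of a normal integral scheme form an integrally closed
domain. -/
theorem isIntegrallyClosed_sections (hX : IsNormalScheme X) {U : X.Opens} (hU : IsAffineOpen U)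
    [IsDomain Γ(X, U)] : IsIntegrallyClosed Γ(X, U) := by
  refine IsIntegrallyClosed.of_localization_maximal fun P _ hP => ?_
  have := hP.isPrime
  obtain ⟨x, hx, rfl⟩ := exists_vanishingIdeal_eq hU P
  let := (X.presheaf.germ U x hx).hom.toAlgebra
  have := isLocalization_stalk hU x hx
  have := (hX x).2
  exact IsIntegrallyClosed.of_equiv (IsLocalization.algEquiv (vanishingIdeal U x hx).primeCompl
    (X.presheaf.stalk x) (Localization.AtPrime (vanishingIdeal U x hx))).toRingEquiv

end VanishingIdeal

/-! ### Rings of sections of an abelian cover -/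

section Stabilizer

/-- Morphisms from an affine scheme to an affine open set are determined by their effect on
sections. -/
theorem hom_ext_of_appLE {S X : Scheme.{u}} [IsAffine S] {W : X.Opens} (hW : IsAffineOpen W)
    {i j : S ⟶ X} (hi : ⊤ ≤ i ⁻¹ᵁ W) (hj : ⊤ ≤ j ⁻¹ᵁ W) (h : i.appLE W ⊤ hi = j.appLE W ⊤ hj) :
    i = j := by
  have h1 := hW.SpecMap_appLE_fromSpec i (isAffineOpen_top S) hi
  have h2 := hW.SpecMap_appLE_fromSpec j (isAffineOpen_top S) hj
  rw [h, h2] at h1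
  have : IsIso (isAffineOpen_top S).fromSpec := by
    rw [IsAffineOpen.fromSpec_top]
    infer_instance
  exact ((cancel_epi _).mp h1).symm

variable {G : Type v} [CommGroup G] {X Y : Scheme.{u}} {π : X ⟶ Y}

/-- The stabilizer of a point of an affine invariant open set is its inertia group in the sense of
commutative algebra. -/
theorem mem_stabilizer_iff (ρ : G →* Aut (Over.mk π)) {V : Y.Opens} (hW : IsAffineOpen (π ⁻¹ᵁ V))
    {x : X} (hx : x ∈ π ⁻¹ᵁ V) (g : G) :
    g ∈ stabilizer ρ x ↔ ∀ b, pull ρ g V b - b ∈ vanishingIdeal (π ⁻¹ᵁ V) x hx := by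
  let i := X.fromSpecResidueField x
  have hi : ⊤ ≤ i ⁻¹ᵁ π ⁻¹ᵁ V := fun s _ => by
    change i s ∈ π ⁻¹ᵁ V
    rwa [Scheme.fromSpecResidueField_apply]
  have hi' : ⊤ ≤ (i ≫ act ρ g) ⁻¹ᵁ π ⁻¹ᵁ V := fun s hs => preimage_le ρ g V (hi hs)
  have key (b : Γ(X, π ⁻¹ᵁ V)) :
      b ∈ vanishingIdeal (π ⁻¹ᵁ V) x hx ↔ i.appLE _ ⊤ hi b = 0 := by
    have hpt : i (IsLocalRing.closedPoint _) = x := Scheme.fromSpecResidueField_apply _ _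
    have h := comap_vanishingIdeal i hi (IsLocalRing.closedPoint _) trivial
    simp only [hpt] at h
    rw [← h, Ideal.mem_comap]
    have hf : IsField Γ(Spec (X.residueField x), ⊤) :=
      (Scheme.ΓSpecIso (X.residueField x)).commRingCatIsoToRingEquiv.toMulEquiv.isField
        (Field.toIsField _)
    have := Ring.isField_iff_isSimpleOrder_ideal.mp hf
    rw [(eq_bot_or_eq_top (vanishingIdeal (⊤ : (Spec (X.residueField x)).Opens)
      (IsLocalRing.closedPoint _) trivial)).resolve_right (vanishingIdeal_isPrime _ _ _).ne_top]
    exact Ideal.mem_bot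
  have hcomp (b : Γ(X, π ⁻¹ᵁ V)) :
      (i ≫ act ρ g).appLE _ ⊤ hi' b = i.appLE _ ⊤ hi (pull ρ g V b) := by
    rw [← Scheme.Hom.appLE_comp_appLE i (act ρ g) (π ⁻¹ᵁ V) (π ⁻¹ᵁ V) ⊤ (preimage_le ρ g V) hi]
    rfl
  simp only [key, map_sub, sub_eq_zero, ← hcomp]
  constructor
  · intro h b
    have h : i ≫ act ρ g = i := h
    simp only [h]
  · intro h
    exact hom_ext_of_appLE hW hi' hi (by ext b; exact h b)

end Stabilizer

section Sections

variable {k : Type u} [Field k] {G : Type v} [CommGroup G] {X Y : Scheme.{u}} {π : X ⟶ Y}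
  (q : Y ⟶ Spec (.of k)) (ρ : G →* Aut (Over.mk π)) (V : Y.Opens)

/-- The ring `Γ(V, 𝒪_Y)` as a `k`-algebra; the type remembers the structure morphism `q`. -/
@[nolint unusedArguments]
def BaseSections (_q : Y ⟶ Spec (.of k)) (V : Y.Opens) : Type u := Γ(Y, V)

/-- The ring `Γ(V, π_* 𝒪_X)` as an algebra over `k` and over `Γ(V, 𝒪_Y)` with an action of `G`;
the type remembers the structure morphism `q` and the action `ρ`. -/
@[nolint unusedArguments]
def CoverSections (_q : Y ⟶ Spec (.of k)) (_ρ : G →* Aut (Over.mk π)) (V : Y.Opens) : Type u :=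
  Γ(X, π ⁻¹ᵁ V)

instance : CommRing (BaseSections q V) := inferInstanceAs (CommRing Γ(Y, V))

instance : CommRing (CoverSections q ρ V) := inferInstanceAs (CommRing Γ(X, π ⁻¹ᵁ V))

instance : Algebra k (BaseSections q V) := (scalar q V).toAlgebra

instance : Algebra k (CoverSections q ρ V) := (scalar (π ≫ q) (π ⁻¹ᵁ V)).toAlgebra

instance : Algebra (BaseSections q V) (CoverSections q ρ V) := (π.app V).hom.toAlgebra

theorem app_scalar (c : k) : (π.app V).hom (scalar q V c) = scalar (π ≫ q) (π ⁻¹ᵁ V) c := by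
  have := Scheme.Hom.appLE_comp_appLE π q ⊤ V (π ⁻¹ᵁ V) le_top le_rfl
  simp only [scalar, ← this, Scheme.Hom.app_eq_appLE]
  rfl

instance : IsScalarTower k (BaseSections q V) (CoverSections q ρ V) :=
  IsScalarTower.of_algebraMap_eq fun c => (app_scalar q V c).symm

theorem pull_one (f : Γ(X, π ⁻¹ᵁ V)) : pull ρ 1 V f = f := by
  simp only [pull, act_one]
  have : (𝟙 X : X ⟶ X).appLE (π ⁻¹ᵁ V) (π ⁻¹ᵁ V) le_rfl = 𝟙 _ := by
    simp only [Scheme.Hom.appLE, Scheme.Hom.id_app]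
    exact X.presheaf.map_id _
  rw [this]; rfl

theorem pull_mul (g h : G) (f : Γ(X, π ⁻¹ᵁ V)) :
    pull ρ (g * h) V f = pull ρ g V (pull ρ h V f) := by
  have := Scheme.Hom.appLE_comp_appLE (act ρ g) (act ρ h) (π ⁻¹ᵁ V) (π ⁻¹ᵁ V) (π ⁻¹ᵁ V)
    (preimage_le ρ h V) (preimage_le ρ g V)
  simp only [← act_mul, mul_comm h g] at this
  simp only [pull, ← this]
  rfl

instance : MulSemiringAction G (CoverSections q ρ V) where
  smul g f := pull ρ g V f
  one_smul := pull_one ρ V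
  mul_smul := pull_mul ρ V
  smul_zero g := map_zero (pull ρ g V)
  smul_add g := map_add (pull ρ g V)
  smul_one g := map_one (pull ρ g V)
  smul_mul g := map_mul (pull ρ g V)

instance : SMulCommClass G (BaseSections q V) (CoverSections q ρ V) where
  smul_comm g a f := by
    rw [Algebra.smul_def, Algebra.smul_def, MulSemiringAction.smul_mul]
    exact congrArg (· * _) (pull_app ρ g V a)

/-- The ring-theoretic eigenspace is the module of sections of `L_χ⁻¹`. -/
theorem mem_eigen_iff {χ : G →* kˣ} {f : CoverSections q ρ V} :
    f ∈ eigen (BaseSections q V) χ ↔ f ∈ (eigenSections q ρ χ V) := by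
  rw [mem_eigen]
  refine forall_congr' fun g => ?_
  rw [Algebra.smul_def]
  rfl

section Isomorphism

variable {q V} {X' : Scheme.{u}} {π' : X' ⟶ Y} {ρ} {ρ' : G →* Aut (Over.mk π')}

/-- The linear equivalence of eigenspaces given by an isomorphism of eigensheaves. -/
def EigensheafIso.linearEquiv {χ : G →* kˣ} (φ : EigensheafIso q ρ ρ' χ) (V : Y.Opens) :
    eigen (B := CoverSections q ρ V) (BaseSections q V) χ ≃ₗ[BaseSections q V]
      eigen (B := CoverSections q ρ' V) (BaseSections q V) χ where
  toFun f := ⟨(φ.toEquiv V ⟨f.1, (mem_eigen_iff q ρ V).mp f.2⟩).1,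
    (mem_eigen_iff q ρ' V).mpr (φ.toEquiv V _).2⟩
  invFun f := ⟨((φ.toEquiv V).symm ⟨f.1, (mem_eigen_iff q ρ' V).mp f.2⟩).1,
    (mem_eigen_iff q ρ V).mpr ((φ.toEquiv V).symm _).2⟩
  left_inv f := Subtype.ext (congrArg Subtype.val
    ((φ.toEquiv V).symm_apply_apply ⟨f.1, (mem_eigen_iff q ρ V).mp f.2⟩))
  right_inv f := Subtype.ext (congrArg Subtype.val
    ((φ.toEquiv V).apply_symm_apply ⟨f.1, (mem_eigen_iff q ρ' V).mp f.2⟩))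
  map_add' f g := Subtype.ext (congrArg Subtype.val
    ((φ.toEquiv V).map_add ⟨f.1, (mem_eigen_iff q ρ V).mp f.2⟩
      ⟨g.1, (mem_eigen_iff q ρ V).mp g.2⟩))
  map_smul' a f := Subtype.ext (congrArg Subtype.val
    (φ.map_smul V a ⟨f.1, (mem_eigen_iff q ρ V).mp f.2⟩))

end Isomorphism

end Sections

/-! ### Ring-theoretic properties of the sections -/

/-- A ring of invariants of an integrally closed domain is integrally closed. -/
theorem isIntegrallyClosed_of_isInvariant (A B : Type*) (G : Type*) [CommRing A] [CommRing B]
    [Algebra A B] [CommGroup G] [MulSemiringAction G B] [SMulCommClass G A B] [IsDomain A] [IsDomain B]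
    [FaithfulSMul A B] [IsIntegrallyClosed B] [Algebra.IsInvariant A B G] :
    IsIntegrallyClosed A := by
  have hinj := FaithfulSMul.algebraMap_injective A B
  rw [isIntegrallyClosed_iff (FractionRing A)]
  intro x hx
  obtain ⟨a, b, hb, rfl⟩ := IsFractionRing.div_surjective (A := A) x
  have hb0 : b ≠ 0 := nonZeroDivisors.ne_zero hb
  have hi : Function.Injective (Algebra.ofId A (FractionRing B)) :=
    (IsFractionRing.injective B (FractionRing B)).comp hinj
  have hx' := (hx.map (IsFractionRing.liftAlgHom hi)).tower_top (A := B)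
  obtain ⟨y, hy⟩ := IsIntegrallyClosed.isIntegral_iff.mp hx'
  have hmap (c : A) : IsFractionRing.liftAlgHom (K := FractionRing A) hi (algebraMap A _ c) =
      algebraMap B (FractionRing B) (algebraMap A B c) := by
    rw [AlgHom.commutes, ← IsScalarTower.algebraMap_apply]
  have hbB : algebraMap A B b ≠ 0 := (map_ne_zero_iff _ hinj).mpr hb0
  have hyb : y * algebraMap A B b = algebraMap A B a := by
    apply IsFractionRing.injective B (FractionRing B)
    rw [map_mul, hy, map_div₀, hmap, hmap, div_mul_cancel₀]
    exact (map_ne_zero_iff _ (IsFractionRing.injective B (FractionRing B))).mpr hbB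
  obtain ⟨c, rfl⟩ := Algebra.IsInvariant.isInvariant (A := A) (G := G) y fun g => by
    apply mul_right_cancel₀ hbB
    rw [hyb]
    conv_lhs => rw [← smul_algebraMap_eq A g b, ← smul_mul', hyb, smul_algebraMap_eq A]
  refine ⟨c, ?_⟩
  rw [← map_mul] at hyb
  rw [eq_div_iff ((map_ne_zero_iff _ (IsFractionRing.injective A _)).mpr hb0), ← map_mul, hinj hyb]

section Sections

variable {k : Type u} [Field k] {G : Type v} [CommGroup G] {X Y : Scheme.{u}} {π : X ⟶ Y}
  {q : Y ⟶ Spec (.of k)} {ρ : G →* Aut (Over.mk π)} {V : Y.Opens}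

theorem isDomain_baseSections (hY : IsVariety q) {y : Y} (hy : y ∈ V) :
    IsDomain (BaseSections q V) := by
  have := hY.isIntegral
  have : Nonempty V := ⟨y, hy⟩
  exact inferInstanceAs (IsDomain Γ(Y, V))

theorem isDomain_coverSections (hX : IsVariety (π ≫ q)) (hπ : IsGCover ρ) {y : Y} (hy : y ∈ V) :
    IsDomain (CoverSections q ρ V) := by
  have := hX.isIntegral
  obtain ⟨x, hx⟩ := hπ.surjective y
  have : Nonempty (π ⁻¹ᵁ V) := ⟨x, show π x ∈ V by rwa [hx]⟩
  exact inferInstanceAs (IsDomain Γ(X, π ⁻¹ᵁ V))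

theorem isNoetherianRing_sections {X : Scheme.{u}} {s : X ⟶ Spec (.of k)} (hX : IsVariety s)
    {U : X.Opens} (hU : IsAffineOpen U) : IsNoetherianRing Γ(X, U) := by
  have := hX.locallyOfFiniteType
  have : IsLocallyNoetherian X := LocallyOfFiniteType.isLocallyNoetherian s
  exact IsLocallyNoetherian.component_noetherian ⟨U, hU⟩

theorem IsGCover.isAffineOpen_preimage (hπ : IsGCover ρ) (hV : IsAffineOpen V) :
    IsAffineOpen (π ⁻¹ᵁ V) :=
  have := hπ.isFinite
  hV.preimage π

theorem faithfulSMul_sections (hπ : IsGCover ρ) :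
    FaithfulSMul (BaseSections q V) (CoverSections q ρ V) :=
  (faithfulSMul_iff_algebraMap_injective _ _).mpr (hπ.injective_app V)

theorem isInvariant_sections (hπ : IsGCover ρ) :
    Algebra.IsInvariant (BaseSections q V) (CoverSections q ρ V) G :=
  ⟨fun b hb => (hπ.mem_range_app_iff V b).mpr hb⟩

/-- The group acts faithfully on the sections over a non-empty open set, because this open set is
dense and `X` is reduced and separated. -/
theorem eq_one_of_forall_smul_eq (hX : IsVariety (π ≫ q)) (hπ : IsGCover ρ)
    (hV : IsAffineOpen V) {y : Y} (hy : y ∈ V) (g : G)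
    (h : ∀ b : CoverSections q ρ V, g • b = b) : g = 1 := by
  have := hX.isIntegral
  have := hX.isSeparated
  have hW := hπ.isAffineOpen_preimage hV
  obtain ⟨x, hx⟩ := hπ.surjective y
  have : Nonempty (π ⁻¹ᵁ V) := ⟨x, show π x ∈ V by rwa [hx]⟩
  have : IsAffine (π ⁻¹ᵁ V) := hW
  let ι := (π ⁻¹ᵁ V).ι
  have hle : ⊤ ≤ ι ⁻¹ᵁ (π ⁻¹ᵁ V) := by simp [ι]
  have hle' : ⊤ ≤ (ι ≫ act ρ g) ⁻¹ᵁ (π ⁻¹ᵁ V) := fun s hs => preimage_le ρ g V (hle hs)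
  have e1 : ι ≫ act ρ g = ι := by
    refine hom_ext_of_appLE hW hle' hle ?_
    rw [← Scheme.Hom.appLE_comp_appLE ι (act ρ g) (π ⁻¹ᵁ V) (π ⁻¹ᵁ V) ⊤ (preimage_le ρ g V) hle]
    ext b
    exact congrArg (ι.appLE _ ⊤ hle) (h b)
  have : IsDominant ι :=
    Opens.isDominant_ι ((π ⁻¹ᵁ V).2.dense ⟨x, show π x ∈ V by rwa [hx]⟩)
  have e2 : act ρ g = 𝟙 X := by
    refine ext_of_isDominant_of_isSeparated (π ≫ q) ?_ ι (by rw [e1, Category.comp_id])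
    rw [← Category.assoc, act_comp, Category.id_comp]
  refine hπ.faithful ?_
  rw [map_one]
  ext1
  ext1
  exact e2

end Sections

/-! ### Inertia groups and conormal characters -/

section Localization

open IsLocalRing

variable {B S : Type*} [CommRing B] [CommRing S] [IsLocalRing S] [Algebra B S] (P : Ideal B)
  [P.IsPrime] [IsLocalization.AtPrime S P]

/-- If `τ` lies in the inertia group at `P` and multiplies the uniformizer `z` by the scalar `c`,
then it acts on the conormal space at `P` as multiplication by `c`. -/
theorem map_sub_mul_mem_maximalIdeal_sq {τ : B →+* B} {σ : S →+* S}
    (hσ : ∀ b, σ (algebraMap B S b) = algebraMap B S (τ b)) (hτ : ∀ b, τ b - b ∈ P) {z c : B}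
    (hzP : z ∈ P) (hz : ∀ b ∈ P, ∃ s ∉ P, ∃ a, s * b = z * a) (hc : τ z = c * z) {f : S}
    (hf : f ∈ maximalIdeal S) : σ f - algebraMap B S c * f ∈ maximalIdeal S ^ 2 := by
  have hu {s : B} (hs : s ∉ P) : IsUnit (algebraMap B S s) :=
    (IsLocalization.AtPrime.isUnit_to_map_iff S P s).mpr hs
  have hm {b : B} (hb : b ∈ P) : algebraMap B S b ∈ maximalIdeal S :=
    (IsLocalization.AtPrime.to_map_mem_maximal_iff S P b).mpr hb
  obtain ⟨b, s, rfl⟩ := IsLocalization.exists_mk'_eq P.primeCompl f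
  have hb : b ∈ P := (IsLocalization.AtPrime.mk'_mem_maximal_iff S P b s).mp hf
  obtain ⟨t, ht, a, e⟩ := hz b hb
  have hts : t * s ∉ P := fun h =>
    ((inferInstance : P.IsPrime).mem_or_mem h).elim ht s.2
  -- the function is the product of the uniformizer and `y`
  obtain ⟨y, hy⟩ : ∃ y : S, y * algebraMap B S (t * s) = algebraMap B S a := by
    obtain ⟨v, hv⟩ := (hu hts).exists_left_inv
    exact ⟨algebraMap B S a * v, by rw [mul_assoc, hv, mul_one]⟩
  have hf' : IsLocalization.mk' S b s = algebraMap B S z * y := by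
    have h1 : IsLocalization.mk' S b s * algebraMap B S s = algebraMap B S b :=
      IsLocalization.mk'_spec S b s
    apply (hu hts).mul_right_cancel
    rw [mul_assoc, hy, ← map_mul, ← e, map_mul, map_mul, ← h1]
    ring
  have hy' : σ y - y ∈ maximalIdeal S := by
    have h1 := congrArg σ hy
    rw [map_mul, hσ, hσ] at h1
    have h2 : (σ y - y) * algebraMap B S (t * s) =
        algebraMap B S (τ a - a) - σ y * algebraMap B S (τ (t * s) - t * s) := by
      rw [map_sub, map_sub, ← h1, ← hy]
      ring
    have h3 : (σ y - y) * algebraMap B S (t * s) ∈ maximalIdeal S := by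
      rw [h2]
      exact Ideal.sub_mem _ (hm (hτ _)) (Ideal.mul_mem_left _ _ (hm (hτ _)))
    exact (Ideal.mul_unit_mem_iff_mem _ (hu hts)).mp h3
  rw [hf', map_mul, hσ, hc, map_mul]
  have : algebraMap B S c * algebraMap B S z * σ y - algebraMap B S c * (algebraMap B S z * y) =
      algebraMap B S c * (algebraMap B S z * (σ y - y)) := by ring
  rw [this, sq]
  exact Ideal.mul_mem_left _ _ (Ideal.mul_mem_mul (hm hzP) hy')

/-- A uniformizer does not lie in the square of the maximal ideal. -/
theorem algebraMap_notMem_maximalIdeal_sq [IsDomain B] {z : B} (hzP : z ∈ P) (hz0 : z ≠ 0)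
    (hz : ∀ b ∈ P, ∃ s ∉ P, ∃ a, s * b = z * a) :
    algebraMap B S z ∉ maximalIdeal S ^ 2 := by
  have hinj : Function.Injective (algebraMap B S) :=
    IsLocalization.injective S P.primeCompl_le_nonZeroDivisors
  have hu {s : B} (hs : s ∉ P) : IsUnit (algebraMap B S s) :=
    (IsLocalization.AtPrime.isUnit_to_map_iff S P s).mpr hs
  have : IsDomain S := IsLocalization.isDomain_of_le_nonZeroDivisors S
    P.primeCompl_le_nonZeroDivisors
  have hspan : maximalIdeal S ≤ Ideal.span {algebraMap B S z} := by
    rw [← IsLocalization.AtPrime.map_eq_maximalIdeal P S, Ideal.map_le_iff_le_comap]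
    intro b hb
    obtain ⟨s, hs, a, e⟩ := hz b hb
    rw [Ideal.mem_comap, ← Ideal.unit_mul_mem_iff_mem _ (hu hs), ← map_mul, e, map_mul]
    exact Ideal.mul_mem_right _ _ (Ideal.mem_span_singleton_self _)
  intro h
  have h1 := Ideal.pow_right_mono hspan 2 h
  rw [Ideal.span_singleton_pow, Ideal.mem_span_singleton] at h1
  obtain ⟨w, hw⟩ := h1
  have hz' : algebraMap B S z ≠ 0 := (map_ne_zero_iff _ hinj).mpr hz0
  have h2 : (1 : S) = algebraMap B S z * w := by
    apply mul_left_cancel₀ hz'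
    rw [mul_one]
    conv_lhs => rw [hw]
    ring
  have h3 : algebraMap B S z ∈ maximalIdeal S :=
    (IsLocalization.AtPrime.to_map_mem_maximal_iff S P z).mpr hzP
  exact h3 (IsUnit.of_mul_eq_one w h2.symm)

end Localization

section Inertia

variable {k : Type u} [Field k] {G : Type v} [CommGroup G] {X Y : Scheme.{u}} {π : X ⟶ Y}
  (q : Y ⟶ Spec (.of k)) (ρ : G →* Aut (Over.mk π)) {V : Y.Opens}

/-- The prime ideal of `Γ(V, 𝒪_Y)` given by a point of `V`. -/
def basePrime (q : Y ⟶ Spec (.of k)) (y : Y) (hy : y ∈ V) : Ideal (BaseSections q V) :=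
  vanishingIdeal V y hy

/-- The prime ideal of `Γ(V, π_* 𝒪_X)` given by a point over `V`. -/
def coverPrime (x : X) (hx : π x ∈ V) : Ideal (CoverSections q ρ V) :=
  vanishingIdeal (π ⁻¹ᵁ V) x hx

instance (y : Y) (hy : y ∈ V) : (basePrime q y hy).IsPrime := vanishingIdeal_isPrime V y hy

instance (x : X) (hx : π x ∈ V) : (coverPrime q ρ x hx).IsPrime :=
  vanishingIdeal_isPrime (π ⁻¹ᵁ V) x hx

theorem under_coverPrime (x : X) (hx : π x ∈ V) :
    (coverPrime q ρ x hx).under (BaseSections q V) = basePrime q (π x) hx := by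
  have := comap_vanishingIdeal π (U := V) le_rfl x hx
  rw [← Scheme.Hom.app_eq_appLE] at this
  exact this

theorem inertia_coverPrime (hW : IsAffineOpen (π ⁻¹ᵁ V)) (x : X) (hx : π x ∈ V) :
    (coverPrime q ρ x hx).inertia G = stabilizer ρ x := by
  ext g
  exact (mem_stabilizer_iff ρ hW hx g).symm

variable {ρ}

theorem IsGCover.stabilizer_le_of_specializes (hπ : IsGCover ρ) {x x' : X} (h : x ⤳ x') :
    stabilizer ρ x ≤ stabilizer ρ x' := fun g hg => by
  obtain ⟨V, hV, hx', -⟩ := exists_isAffineOpen_mem_and_subset (x := π x') (U := ⊤) trivial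
  have hW := hπ.isAffineOpen_preimage hV
  have hx : x ∈ π ⁻¹ᵁ V := h.mem_open (π ⁻¹ᵁ V).2 hx'
  rw [mem_stabilizer_iff ρ hW hx'] 
  rw [mem_stabilizer_iff ρ hW hx] at hg
  exact fun b => vanishingIdeal_le_of_specializes hx hx' h (hg b)

theorem IsGCover.inertia_closure (hπ : IsGCover ρ) (x : X) :
    inertia ρ (closure {x}) = stabilizer ρ x := by
  refine le_antisymm (iInf₂_le x (subset_closure (Set.mem_singleton x))) (le_iInf₂ fun x' hx' => ?_)
  exact hπ.stabilizer_le_of_specializes (specializes_iff_mem_closure.mpr hx')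

theorem act_apply_of_mem_stabilizer {x : X} {g : G} (hg : g ∈ stabilizer ρ x) :
    act ρ g x = x := by
  have h : X.fromSpecResidueField x ≫ act ρ g = X.fromSpecResidueField x := hg
  let pt : Spec (X.residueField x) := IsLocalRing.closedPoint (X.residueField x)
  have e : (X.fromSpecResidueField x ≫ act ρ g) pt = X.fromSpecResidueField x pt := by rw [h]
  rwa [Scheme.Hom.comp_apply, Scheme.fromSpecResidueField_apply] at e

/-- The action of an element of the stabilizer of `x` on the local ring at `x`. -/
theorem exists_stalk_map {x : X} {g : G} (hg : g ∈ stabilizer ρ x) :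
    ∃ σ : X.presheaf.stalk x →+* X.presheaf.stalk x,
      ∀ (U : X.Opens) (hU : x ∈ U) (hU' : x ∈ act ρ g ⁻¹ᵁ U) (f : Γ(X, U)),
        σ (X.presheaf.germ U x hU f) = X.presheaf.germ _ x hU' ((act ρ g).app U f) := by
  have h : act ρ g x ⤳ x := specializes_of_eq (act_apply_of_mem_stabilizer hg)
  refine ⟨(X.presheaf.stalkSpecializes h ≫ (act ρ g).stalkMap x).hom, fun U hU hU' f => ?_⟩
  have h1 : X.presheaf.germ U x hU ≫ X.presheaf.stalkSpecializes h ≫ (act ρ g).stalkMap x =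
      (act ρ g).app U ≫ X.presheaf.germ _ x hU' := by
    rw [← Category.assoc, X.presheaf.germ_stalkSpecializes, Scheme.Hom.germ_stalkMap]
  exact congrArg (fun φ => φ.hom f) h1

theorem germ_app_eq {x : X} (hx : x ∈ π ⁻¹ᵁ V) {g : G} (hx' : x ∈ act ρ g ⁻¹ᵁ π ⁻¹ᵁ V)
    (f : Γ(X, π ⁻¹ᵁ V)) : X.presheaf.germ _ x hx' ((act ρ g).app (π ⁻¹ᵁ V) f) =
      X.presheaf.germ _ x hx (pull ρ g V f) := by
  simp only [pull, Scheme.Hom.appLE]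
  exact (X.presheaf.germ_res_apply (homOfLE (preimage_le ρ g V)) x hx _).symm

theorem germ_scalar {s : X ⟶ Spec (.of k)} {x : X} {U W : X.Opens} (hU : x ∈ U) (hW : x ∈ W)
    (c : k) : X.presheaf.germ U x hU (scalar s U c) = X.presheaf.germ W x hW (scalar s W c) := by
  have h1 := X.presheaf.germ_res_apply (homOfLE (inf_le_left : U ⊓ W ≤ U)) x ⟨hU, hW⟩ (scalar s U c)
  have h2 := X.presheaf.germ_res_apply (homOfLE (inf_le_right : U ⊓ W ≤ W)) x ⟨hU, hW⟩
    (scalar s W c)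
  rw [← h1, ← h2]
  exact congrArg _ ((res_scalar s inf_le_left c).trans (res_scalar s inf_le_right c).symm)

/-- A uniformizer that is an eigenfunction for `χ` determines the character of the conormal
space. -/
theorem hasInertiaDatum_iff (hπ : IsGCover ρ) (hX : IsVariety (π ≫ q)) (hV : IsAffineOpen V)
    {x : X} (hx : π x ∈ V) {χ : G →* kˣ} {z : CoverSections q ρ V}
    (hzχ : z ∈ eigen (BaseSections q V) χ) (hz0 : z ≠ 0) (hzP : z ∈ coverPrime q ρ x hx)
    (hz : ∀ b ∈ coverPrime q ρ x hx, ∃ s ∉ coverPrime q ρ x hx, ∃ a, s * b = z * a)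
    {H : Subgroup G} (ψ : H →* kˣ) :
    HasInertiaDatum q ρ (closure {x}) H ψ ↔ stabilizer ρ x = H ∧ ∀ h : H, ψ h = χ h := by
  have hW := hπ.isAffineOpen_preimage hV
  have := isDomain_coverSections (q := q) hX hπ hx
  let _ : Algebra (CoverSections q ρ V) (X.presheaf.stalk x) :=
    (X.presheaf.germ (π ⁻¹ᵁ V) x hx).hom.toAlgebra
  have hloc : IsLocalization.AtPrime (X.presheaf.stalk x) (coverPrime q ρ x hx) :=
    isLocalization_stalk hW x hx
  rw [HasInertiaDatum, hπ.inertia_closure]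
  refine and_congr_right fun hH => ?_
  subst hH
  constructor
  · rintro ⟨η, hη, hdat⟩ h
    obtain rfl : η = x := (isGenericPoint_closure (x := x)).eq hη |>.symm
    have hx' : η ∈ act ρ (h : G) ⁻¹ᵁ π ⁻¹ᵁ V := preimage_le ρ h V hx
    have h1 := hdat h (π ⁻¹ᵁ V) hx hx' z hzP
    have h0 : X.presheaf.germ _ η hx' ((act ρ (h : G)).app (π ⁻¹ᵁ V) z) =
      X.presheaf.germ (π ⁻¹ᵁ V) η hx (pull ρ h V z) := germ_app_eq hx hx' z
    rw [h0] at h1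
    by_contra hne
    have h2 : pull ρ h V z = scalar (π ≫ q) (π ⁻¹ᵁ V) (χ h : k) * (show Γ(X, π ⁻¹ᵁ V) from z) :=
      (mem_eigen_iff q ρ V).mp hzχ h
    rw [h2, ← map_sub, ← sub_mul, ← map_sub, map_mul] at h1
    have hu : IsUnit ((χ h : k) - ψ h) :=
      (sub_ne_zero.mpr fun e => hne (Units.ext e.symm)).isUnit
    have hu' := (hu.map (scalar (π ≫ q) (π ⁻¹ᵁ V))).map (X.presheaf.germ (π ⁻¹ᵁ V) η hx).hom
    exact algebraMap_notMem_maximalIdeal_sq (coverPrime q ρ η hx) hzP hz0 hz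
      ((Ideal.unit_mul_mem_iff_mem _ hu').mp h1)
  · intro hψ
    refine ⟨x, isGenericPoint_closure, fun h U hU hU' f hf => ?_⟩
    obtain ⟨σ, hσ⟩ := exists_stalk_map h.2
    rw [← hσ U hU hU', map_mul, germ_scalar hU (show x ∈ π ⁻¹ᵁ V from hx), hψ]
    refine map_sub_mul_mem_maximalIdeal_sq (coverPrime q ρ x hx) (τ := pull ρ h V) (σ := σ)
      (fun b => ?_) ((mem_stabilizer_iff ρ hW hx h).mp h.2) hzP hz
      ((mem_eigen_iff q ρ V).mp hzχ h) hf
    exact (hσ _ hx (preimage_le ρ h V hx) b).trans (germ_app_eq hx _ b)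

end Inertia

/-! ### Components of the branch locus -/

/-- The inertia groups are trivial outside a proper closed subset of the base. -/
theorem exists_algebraMap_mem_of_inertia_ne_bot (A : Type*) {B : Type*} {G : Type*} [CommRing A]
    [CommRing B] [IsDomain B] [Algebra A B] [CommGroup G] [Finite G] [MulSemiringAction G B]
    [Algebra.IsInvariant A B G] (hfaith : ∀ g : G, (∀ b : B, g • b = b) → g = 1) :
    ∃ a : A, a ≠ 0 ∧ ∀ (P : Ideal B) [P.IsPrime], P.inertia G ≠ ⊥ → algebraMap A B a ∈ P := by
  classical
  have := Fintype.ofFinite G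
  have h (g : G) : ∃ b : B, g ≠ 1 → g • b - b ≠ 0 := by
    by_cases hg : g = 1
    · exact ⟨0, fun h => absurd hg h⟩
    · by_contra! hcon
      exact hg (hfaith g fun b => sub_eq_zero.mp (hcon b).2)
  choose b hb using h
  let d : B := ∏ g ∈ Finset.univ.erase (1 : G), (g • b g - b g)
  have hd : d ≠ 0 := Finset.prod_ne_zero_iff.mpr fun g hg => hb g (Finset.ne_of_mem_erase hg)
  obtain ⟨a, ha⟩ := Algebra.IsInvariant.isInvariant (A := A) (G := G) (∏ g : G, g • d) fun g => by
    rw [Finset.smul_prod']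
    simp only [smul_smul]
    exact Fintype.prod_bijective (g * ·) (Group.mulLeft_bijective g) _ _ fun _ => rfl
  refine ⟨a, ?_, fun P _ hP => ?_⟩
  · rintro rfl
    rw [map_zero] at ha
    obtain ⟨g, -, hg⟩ := Finset.prod_eq_zero_iff.mp ha.symm
    exact hd ((smul_eq_zero_iff_eq g).mp hg)
  · obtain ⟨⟨g, hg⟩, hg1⟩ := Subgroup.ne_bot_iff_exists_ne_one.mp hP
    replace hg1 : g ≠ 1 := fun h => hg1 (Subtype.ext h)
    rw [ha]
    refine Ideal.mem_of_dvd _ (Finset.dvd_prod_of_mem _ (Finset.mem_univ 1)) ?_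
    rw [one_smul]
    exact Ideal.mem_of_dvd _
      (Finset.dvd_prod_of_mem _ (Finset.mem_erase.mpr ⟨hg1, Finset.mem_univ _⟩)) (hg (b g))

/-- The closure of a point is a component of `S` if the point has no proper generization in some
closed set containing `S`. -/
theorem isComponentOf_closure {Z : Type u} [TopologicalSpace Z] [QuasiSober Z] {z : Z} {S C : Set Z}
    (hS : closure {z} ⊆ S) (hC : IsClosed C) (hSC : S ⊆ C) (h : ∀ ξ ∈ C, ξ ⤳ z → z ⤳ ξ) :
    IsComponentOf (closure {z}) S := by
  refine ⟨⟨isIrreducible_singleton.closure, hS⟩, fun T hT hle => ?_⟩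
  obtain ⟨ξ, hξ⟩ := QuasiSober.sober hT.1.closure isClosed_closure
  have hξC : ξ ∈ C := (closure_minimal (hT.2.trans hSC) hC) hξ.mem
  have h1 : ξ ⤳ z := hξ.specializes (subset_closure (hle (subset_closure rfl)))
  have h2 := (h ξ hξC h1).closure_subset
  rw [hξ.def] at h2
  exact subset_closure.trans h2

section Components

variable {k : Type u} [Field k] {G : Type v} [CommGroup G] {X Y : Scheme.{u}} {π : X ⟶ Y}
  {q : Y ⟶ Spec (.of k)} {ρ : G →* Aut (Over.mk π)} {V : Y.Opens}

theorem IsGCover.map_closure (hπ : IsGCover ρ) (x : X) : π '' closure {x} = closure {π x} := by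
  have := hπ.isFinite
  rw [← π.isClosedMap.closure_image_eq_of_continuous π.continuous, Set.image_singleton]

theorem IsGCover.closure_subset_ramificationLocus (hπ : IsGCover ρ) {x : X}
    (hx : x ∈ ramificationLocus ρ) : closure {x} ⊆ ramificationLocus ρ := fun x' hx' h => by
  have := hπ.stabilizer_le_of_specializes (specializes_iff_mem_closure.mpr hx')
  rw [h] at this
  exact hx (le_bot_iff.mp this)

theorem IsGCover.closure_subset_branchLocus (hπ : IsGCover ρ) {y : Y} (hy : y ∈ branchLocus ρ) :
    closure {y} ⊆ branchLocus ρ := by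
  obtain ⟨x, hx, rfl⟩ := hy
  rw [← hπ.map_closure]
  exact Set.image_mono (hπ.closure_subset_ramificationLocus hx)

theorem IsGCover.isIntegral_sections [Finite G] (hπ : IsGCover ρ) :
    Algebra.IsIntegral (BaseSections q V) (CoverSections q ρ V) :=
  have := isInvariant_sections (q := q) (V := V) hπ
  Algebra.IsInvariant.isIntegral _ _ G

/-- The branch locus is contained in a proper closed subset. -/
theorem exists_disjoint_basicOpen [Finite G] (hX : IsVariety (π ≫ q))
    (hπ : IsGCover ρ) (hV : IsAffineOpen V) {y : Y} (hy : y ∈ V) :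
    ∃ a : Γ(Y, V), a ≠ 0 ∧ branchLocus ρ ⊆ (Y.basicOpen a : Set Y)ᶜ := by
  have := isDomain_coverSections (q := q) hX hπ hy
  have := isInvariant_sections (q := q) (V := V) hπ
  obtain ⟨a, ha, h⟩ := exists_algebraMap_mem_of_inertia_ne_bot (BaseSections q V)
    (eq_one_of_forall_smul_eq (q := q) hX hπ hV hy)
  refine ⟨a, ha, ?_⟩
  rintro _ ⟨x, hx, rfl⟩ hm
  have hxV : π x ∈ V := Y.basicOpen_le a hm
  have hP := h (coverPrime q ρ x hxV) (by
    rwa [inertia_coverPrime q ρ (hπ.isAffineOpen_preimage hV)])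
  have : a ∈ (coverPrime q ρ x hxV).under (BaseSections q V) := hP
  rw [under_coverPrime] at this
  exact mem_vanishingIdeal_iff_notMem_basicOpen.mp this hm

/-- A point of codimension one has no proper generization on a proper closed subset. -/
theorem eq_of_specializes_of_notMem_basicOpen (hV : IsAffineOpen V) {y ξ : Y}
    (hy : y ∈ V) [IsDomain (BaseSections q V)]
    [IsDiscreteValuationRing (Localization.AtPrime (basePrime q y hy))]
    {a : Γ(Y, V)} (ha : a ≠ 0) (hξ : ξ ∉ Y.basicOpen a) (h : ξ ⤳ y) : ξ = y := by
  have hξV : ξ ∈ V := h.mem_open V.2 hy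
  have h1 : basePrime q ξ hξV ≤ basePrime q y hy := vanishingIdeal_le_of_specializes _ _ h
  have h2 : basePrime q ξ hξV ≠ ⊥ := (Submodule.ne_bot_iff _).mpr
    ⟨a, mem_vanishingIdeal_iff_notMem_basicOpen.mpr hξ, ha⟩
  have h3 := eq_of_le_of_isDiscreteValuationRing _ h2 h1
  exact (h.antisymm (specializes_of_vanishingIdeal_le hV hy hξV h3.ge)).eq

/-- Finite morphisms have no specializations inside their fibres. -/
theorem IsGCover.eq_of_specializes [Finite G] (hπ : IsGCover ρ) (q : Y ⟶ Spec (.of k))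
    (hV : IsAffineOpen V) {x ξ : X}
    (hx : π x ∈ V) (h : ξ ⤳ x) (e : π ξ = π x) : ξ = x := by
  have hξV : π ξ ∈ V := e ▸ hx
  have := hπ.isIntegral_sections (q := q) (V := V)
  have h1 : coverPrime q ρ ξ hξV ≤ coverPrime q ρ x hx := vanishingIdeal_le_of_specializes _ _ h
  have h2 := eq_of_le_of_under_eq (A := BaseSections q V) h1 (by
    rw [under_coverPrime, under_coverPrime]
    simp only [e])
  exact (h.antisymm (specializes_of_vanishingIdeal_le (hπ.isAffineOpen_preimage hV) hx hξV
    h2.ge)).eq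

theorem isComponentOf_branchLocus [Finite G] (hX : IsVariety (π ≫ q))
    (hπ : IsGCover ρ) (hV : IsAffineOpen V) {y : Y} (hy : y ∈ V)
    [IsDomain (BaseSections q V)]
    [IsDiscreteValuationRing (Localization.AtPrime (basePrime q y hy))]
    (hyD : y ∈ branchLocus ρ) : IsComponentOf (closure {y}) (branchLocus ρ) := by
  obtain ⟨a, ha, hD⟩ := exists_disjoint_basicOpen (q := q) hX hπ hV hy
  refine isComponentOf_closure (hπ.closure_subset_branchLocus hyD)
    (Y.basicOpen a).2.isClosed_compl hD fun ξ hξ h => ?_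
  rw [eq_of_specializes_of_notMem_basicOpen (q := q) hV hy ha hξ h]

theorem isComponentOf_ramificationLocus [Finite G] (hX : IsVariety (π ≫ q))
    (hπ : IsGCover ρ) (hV : IsAffineOpen V) {x : X} (hx : π x ∈ V)
    [IsDomain (BaseSections q V)]
    [IsDiscreteValuationRing (Localization.AtPrime (basePrime q (π x) hx))]
    (hxR : x ∈ ramificationLocus ρ) : IsComponentOf (closure {x}) (ramificationLocus ρ) := by
  obtain ⟨a, ha, hD⟩ := exists_disjoint_basicOpen (q := q) hX hπ hV hx
  refine isComponentOf_closure (hπ.closure_subset_ramificationLocus hxR)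
    ((Y.basicOpen a).2.isClosed_compl.preimage π.continuous)
    (fun x' hx' => hD ⟨x', hx', rfl⟩) fun ξ hξ h => ?_
  have e := eq_of_specializes_of_notMem_basicOpen (q := q) hV hx ha hξ (h.map π.continuous)
  rw [hπ.eq_of_specializes q hV hx h e]

variable [Finite G] [IsAlgClosed k] (hG : (Nat.card G : k) ≠ 0)
  (hX : IsVariety (π ≫ q)) (hN : IsNormalScheme X) (hπ : IsGCover ρ) (hV : IsAffineOpen V)

include hG hX hN hπ hV

theorem exists_eigen_uniformizer {x : X} (hx : π x ∈ V)
    [IsDomain (BaseSections q V)]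
    [IsDiscreteValuationRing (Localization.AtPrime (basePrime q (π x) hx))] :
    ∃ χ : G →* kˣ, ∃ z ∈ eigen (BaseSections q V) χ, z ≠ 0 ∧ z ∈ coverPrime q ρ x hx ∧
      ∀ b ∈ coverPrime q ρ x hx, ∃ s ∉ coverPrime q ρ x hx, ∃ a, s * b = z * a := by
  have := Fintype.ofFinite G
  have := Fintype.ofFinite (G →* kˣ)
  have := isDomain_coverSections (q := q) hX hπ hx
  have := faithfulSMul_sections (q := q) (V := V) hπ
  have := isInvariant_sections (q := q) (V := V) hπ
  have := hπ.isIntegral_sections (q := q) (V := V)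
  have hW := hπ.isAffineOpen_preimage hV
  have : IsNoetherianRing (CoverSections q ρ V) := isNoetherianRing_sections hX hW
  have : IsDomain Γ(X, π ⁻¹ᵁ V) := ‹IsDomain (CoverSections q ρ V)›
  have : IsIntegrallyClosed (CoverSections q ρ V) := isIntegrallyClosed_sections hN hW
  have := isDiscreteValuationRing_of_under_eq _ _ (under_coverPrime q ρ x hx)
  obtain ⟨χ, z, hz, h⟩ := exists_mem_eigen_ordAt_eq_one (BaseSections q V)
    (by rwa [← Nat.card_eq_fintype_card] : (Fintype.card G : k) ≠ 0) (coverPrime q ρ x hx)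
  exact ⟨χ, z, hz, (ordAt_eq_one_iff _).mp h⟩

theorem exists_hasInertiaAt_of_mem_branchLocus {y : Y} (hy : y ∈ V)
    [IsDomain (BaseSections q V)]
    [IsDiscreteValuationRing (Localization.AtPrime (basePrime q y hy))]
    (hyD : y ∈ branchLocus ρ) :
    ∃ (H : Subgroup G) (χ : G →* kˣ),
      HasInertiaAt k (CoverSections q ρ V) (basePrime q y hy) H χ ∧
      y ∈ branchDivisor q ρ H (χ.comp H.subtype) := by
  have hW := hπ.isAffineOpen_preimage hV
  have hcomp := isComponentOf_branchLocus hX hπ hV hy hyD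
  obtain ⟨x, hxR, rfl⟩ := hyD
  obtain ⟨χ, z, hz, hz0, hzP, hz1⟩ := exists_eigen_uniformizer hG hX hN hπ hV hy
  refine ⟨stabilizer ρ x, χ, ⟨coverPrime q ρ x hy, inferInstance, under_coverPrime q ρ x hy,
    inertia_coverPrime q ρ hW x hy, z, hz, hz0, hzP, hz1⟩, ?_⟩
  refine ⟨closure {π x}, ⟨hcomp, closure {x},
    isComponentOf_ramificationLocus hX hπ hV hy hxR, hπ.map_closure x, ?_⟩,
    subset_closure rfl⟩
  exact (hasInertiaDatum_iff q hπ hX hV hy hz hz0 hzP hz1 _).mpr ⟨rfl, fun h => rfl⟩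

theorem exists_hasInertiaAt_of_mem_branchDivisor {y : Y} (hy : y ∈ V)
    [IsDomain (BaseSections q V)]
    [IsDiscreteValuationRing (Localization.AtPrime (basePrime q y hy))] {H : Subgroup G}
    {ψ : H →* kˣ} (hyD : y ∈ branchDivisor q ρ H ψ) :
    ∃ χ : G →* kˣ, HasInertiaAt k (CoverSections q ρ V) (basePrime q y hy) H χ ∧
      ∀ h : H, ψ h = χ h := by
  have hW := hπ.isAffineOpen_preimage hV
  obtain ⟨a, ha, hD⟩ := exists_disjoint_basicOpen (q := q) hX hπ hV hy
  obtain ⟨E, ⟨-, T, hT, rfl, hdat⟩, hyE⟩ := hyD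
  obtain ⟨x, hx, -⟩ := hdat.2
  rw [← hx.def] at hdat hT hyE
  have hxR : x ∈ ramificationLocus ρ := hT.1.2 (subset_closure rfl)
  rw [hπ.map_closure] at hyE
  obtain rfl : π x = y := eq_of_specializes_of_notMem_basicOpen (q := q) hV hy ha
    (hD ⟨x, hxR, rfl⟩) (specializes_iff_mem_closure.mpr hyE)
  obtain ⟨χ, z, hz, hz0, hzP, hz1⟩ := exists_eigen_uniformizer hG hX hN hπ hV hy
  obtain ⟨rfl, h⟩ := (hasInertiaDatum_iff q hπ hX hV hy hz hz0 hzP hz1 ψ).mp hdat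
  exact ⟨χ, ⟨coverPrime q ρ x hy, inferInstance, under_coverPrime q ρ x hy,
    inertia_coverPrime q ρ hW x hy, z, hz, hz0, hzP, hz1⟩, h⟩

theorem exists_hasInertiaAt_of_notMem_branchLocus {y : Y} (hy : y ∈ V)
    [IsDomain (BaseSections q V)]
    [IsDiscreteValuationRing (Localization.AtPrime (basePrime q y hy))]
    (hyD : y ∉ branchLocus ρ) :
    ∃ χ : G →* kˣ, HasInertiaAt k (CoverSections q ρ V) (basePrime q y hy) ⊥ χ := by
  have hW := hπ.isAffineOpen_preimage hV
  obtain ⟨x, rfl⟩ := hπ.surjective y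
  have hx : stabilizer ρ x = ⊥ := by
    by_contra h
    exact hyD ⟨x, h, rfl⟩
  obtain ⟨χ, z, hz, hz0, hzP, hz1⟩ := exists_eigen_uniformizer hG hX hN hπ hV hy
  exact ⟨χ, ⟨coverPrime q ρ x hy, inferInstance, under_coverPrime q ρ x hy,
    (inertia_coverPrime q ρ hW x hy).trans hx, z, hz, hz0, hzP, hz1⟩⟩

end Components

section Comparison

variable {k : Type u} [Field k] [IsAlgClosed k] {G : Type v} [CommGroup G] [Finite G]
  {X X' Y : Scheme.{u}} {π : X ⟶ Y} {π' : X' ⟶ Y} {q : Y ⟶ Spec (.of k)}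
  {ρ : G →* Aut (Over.mk π)} {ρ' : G →* Aut (Over.mk π')} {V : Y.Opens}

/-- Equality of the divisors `D_{H,ψ}` means that both covers have the same inertia data at every
point of codimension one. -/
theorem exists_hasInertiaAt_of_branchDivisor_eq (hG : (Nat.card G : k) ≠ 0)
    (hX : IsVariety (π ≫ q)) (hN : IsNormalScheme X) (hπ : IsGCover ρ)
    (hX' : IsVariety (π' ≫ q)) (hN' : IsNormalScheme X') (hπ' : IsGCover ρ')
    (hdata : ∀ (H : Subgroup G) (ψ : H →* kˣ), branchDivisor q ρ H ψ = branchDivisor q ρ' H ψ)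
    (hV : IsAffineOpen V) [IsDomain (BaseSections q V)] (p : Ideal (BaseSections q V)) [p.IsPrime]
    (hp : IsDiscreteValuationRing (Localization.AtPrime p)) :
    ∃ (H : Subgroup G) (χ χ' : G →* kˣ), HasInertiaAt k (CoverSections q ρ V) p H χ ∧
      HasInertiaAt k (CoverSections q ρ' V) p H χ' ∧ ∀ h ∈ H, χ h = χ' h := by
  obtain ⟨y, hy, e⟩ := exists_vanishingIdeal_eq hV p (hP := ‹p.IsPrime›)
  change basePrime q y hy = p at e
  subst e
  by_cases h1 : y ∈ branchLocus ρ
  · obtain ⟨H, χ, h, hyD⟩ := exists_hasInertiaAt_of_mem_branchLocus hG hX hN hπ hV hy h1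
    rw [hdata] at hyD
    obtain ⟨χ', h', e⟩ := exists_hasInertiaAt_of_mem_branchDivisor hG hX' hN' hπ' hV hy hyD
    exact ⟨H, χ, χ', h, h', fun g hg => e ⟨g, hg⟩⟩
  by_cases h2 : y ∈ branchLocus ρ'
  · obtain ⟨H, χ', h', hyD⟩ := exists_hasInertiaAt_of_mem_branchLocus hG hX' hN' hπ' hV hy h2
    rw [← hdata] at hyD
    obtain ⟨χ, h, e⟩ := exists_hasInertiaAt_of_mem_branchDivisor hG hX hN hπ hV hy hyD
    exact ⟨H, χ, χ', h, h', fun g hg => (e ⟨g, hg⟩).symm⟩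
  · obtain ⟨χ, h⟩ := exists_hasInertiaAt_of_notMem_branchLocus hG hX hN hπ hV hy h1
    obtain ⟨χ', h'⟩ := exists_hasInertiaAt_of_notMem_branchLocus hG hX' hN' hπ' hV hy h2
    refine ⟨⊥, χ, χ', h, h', fun g hg => ?_⟩
    rw [Subgroup.mem_bot.mp hg, map_one, map_one]

end Comparison

/-! ### From rings to schemes -/

section Descent

open Limits
open scoped TensorProduct

/-- The preimage of an affine open set is a base change. -/
theorem isPullback_fromSpec {X Y : Scheme.{u}} (π : X ⟶ Y) {V : Y.Opens} (hV : IsAffineOpen V)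
    (hW : IsAffineOpen (π ⁻¹ᵁ V)) :
    IsPullback (Spec.map (π.app V)) hW.fromSpec hV.fromSpec π := by
  refine IsOpenImmersion.isPullback _ _ _ _ ?_ ?_
  · rw [Scheme.Hom.app_eq_appLE]
    exact (IsAffineOpen.SpecMap_appLE_fromSpec π hV hW le_rfl).symm
  · rw [hV.opensRange_fromSpec, hW.opensRange_fromSpec]

variable {G : Type v} [CommGroup G] {X X' Y : Scheme.{u}} {π : X ⟶ Y} {π' : X' ⟶ Y}
  {ρ : G →* Aut (Over.mk π)} {ρ' : G →* Aut (Over.mk π')}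

/-- The base change of the action of `g` to the fibre product. -/
def pullbackAct (ρ : G →* Aut (Over.mk π)) (g : G) {U : Scheme.{u}} (f : U ⟶ Y) :
    pullback π f ⟶ pullback π f :=
  pullback.lift (pullback.fst π f ≫ act ρ g) (pullback.snd π f)
    (by rw [Category.assoc, act_comp, pullback.condition])

theorem pullbackAct_fst (ρ : G →* Aut (Over.mk π)) (g : G) {U : Scheme.{u}} (f : U ⟶ Y) :
    pullbackAct ρ g f ≫ pullback.fst π f = pullback.fst π f ≫ act ρ g := pullback.lift_fst _ _ _

theorem pullbackAct_snd (ρ : G →* Aut (Over.mk π)) (g : G) {U : Scheme.{u}} (f : U ⟶ Y) :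
    pullbackAct ρ g f ≫ pullback.snd π f = pullback.snd π f := pullback.lift_snd _ _ _

theorem isoPullback_hom_comp_pullbackAct {U P : Scheme.{u}} {f : U ⟶ Y} {p₁ : P ⟶ U} {p₂ : P ⟶ X}
    (h : IsPullback p₂ p₁ π f) {γ : P ⟶ P} (g : G) (h1 : γ ≫ p₁ = p₁) (h2 : γ ≫ p₂ = p₂ ≫ act ρ g) :
    h.isoPullback.hom ≫ pullbackAct ρ g f = γ ≫ h.isoPullback.hom := by
  apply pullback.hom_ext
  · rw [Category.assoc, Category.assoc, h.isoPullback_hom_fst, h2, pullbackAct_fst,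
      h.isoPullback_hom_fst_assoc]
  · rw [Category.assoc, Category.assoc, h.isoPullback_hom_snd, h1, pullbackAct_snd,
      h.isoPullback_hom_snd]

/-- Equivariant isomorphisms of the base changes may be given on any models of these. -/
theorem isoOver_of_isPullback {U P P' : Scheme.{u}} {f : U ⟶ Y} {p₁ : P ⟶ U} {p₂ : P ⟶ X}
    {p₁' : P' ⟶ U} {p₂' : P' ⟶ X'} (h : IsPullback p₂ p₁ π f) (h' : IsPullback p₂' p₁' π' f)
    (θ : P ≅ P') (hθ : θ.hom ≫ p₁' = p₁)
    (hG : ∀ g : G, ∃ (γ : P ⟶ P) (γ' : P' ⟶ P'), γ ≫ p₁ = p₁ ∧ γ ≫ p₂ = p₂ ≫ act ρ g ∧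
      γ' ≫ p₁' = p₁' ∧ γ' ≫ p₂' = p₂' ≫ act ρ' g ∧ γ ≫ θ.hom = θ.hom ≫ γ') :
    IsoOver ρ ρ' f := by
  refine ⟨Over.isoMk (h.isoPullback.symm ≪≫ θ ≪≫ h'.isoPullback) ?_, fun g => ?_⟩
  · change (h.isoPullback.inv ≫ θ.hom ≫ h'.isoPullback.hom) ≫ pullback.snd _ _ = pullback.snd _ _
    simp [hθ]
  · obtain ⟨γ, γ', h1, h2, h1', h2', e⟩ := hG g
    have e1 := isoPullback_hom_comp_pullbackAct h g h1 h2
    have e2 := isoPullback_hom_comp_pullbackAct h' g h1' h2'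
    ext1
    change pullbackAct ρ g f ≫ h.isoPullback.inv ≫ θ.hom ≫ h'.isoPullback.hom
      = (h.isoPullback.inv ≫ θ.hom ≫ h'.isoPullback.hom) ≫ pullbackAct ρ' g f
    rw [Category.assoc, Category.assoc, e2, ← Category.assoc θ.hom, ← e, Category.assoc,
      ← cancel_epi h.isoPullback.hom, ← Category.assoc, e1]
    simp

section Affine

variable {A B B' : Type u} [CommRing A] [CommRing B] [CommRing B'] [Algebra A B] [Algebra A B']
  [MulSemiringAction G B] [MulSemiringAction G B'] [SMulCommClass G A B] [SMulCommClass G A B']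

/-- If the spectrum of `B` is the base change of the cover to the spectrum of `A`, then the spectrum
of `A₁ ⊗ B` is its base change to the spectrum of the `A`-algebra `A₁`. -/
theorem isPullback_tensorProduct {i : Spec (.of A) ⟶ Y} {j : Spec (.of B) ⟶ X}
    (h : IsPullback j (Spec.map (CommRingCat.ofHom (algebraMap A B))) π i)
    (A₁ : Type u) [CommRing A₁] [Algebra A A₁] :
    IsPullback
      (Spec.map (CommRingCat.ofHom
        (Algebra.TensorProduct.includeRight : B →ₐ[A] A₁ ⊗[A] B).toRingHom) ≫ j)
      (Spec.map (CommRingCat.ofHom (Algebra.TensorProduct.includeLeftRingHom : A₁ →+* A₁ ⊗[A] B)))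
      π (Spec.map (CommRingCat.ofHom (algebraMap A A₁)) ≫ i) :=
  ((isPullback_SpecMap_of_isPushout _ _ _ _
    (CommRingCat.isPushout_tensorProduct A A₁ B)).flip.paste_horiz h.flip.flip)

theorem SpecMap_comp_SpecMap {R S T S' : Type u} [CommRing R] [CommRing S] [CommRing S']
    [CommRing T] {a : R →+* S} {b : S →+* T} {c : R →+* S'} {d : S' →+* T}
    (h : ∀ r, b (a r) = d (c r)) :
    Spec.map (CommRingCat.ofHom b) ≫ Spec.map (CommRingCat.ofHom a) =
      Spec.map (CommRingCat.ofHom d) ≫ Spec.map (CommRingCat.ofHom c) := by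
  rw [← Spec.map_comp, ← Spec.map_comp]
  congr 1
  ext r
  exact h r

theorem SpecMap_comp_SpecMap_eq {R S T : Type u} [CommRing R] [CommRing S] [CommRing T]
    {a : R →+* S} {b : S →+* T} {c : R →+* T} (h : ∀ r, b (a r) = c r) :
    Spec.map (CommRingCat.ofHom b) ≫ Spec.map (CommRingCat.ofHom a) =
      Spec.map (CommRingCat.ofHom c) := by
  rw [← Spec.map_comp]
  congr 1
  ext r
  exact h r

/-- The isomorphism of spectra given by an isomorphism of rings. -/
def specIso {R S : Type u} [CommRing R] [CommRing S] (e : R ≃+* S) :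
    Spec (.of R) ≅ Spec (.of S) where
  hom := Spec.map (CommRingCat.ofHom e.symm.toRingHom)
  inv := Spec.map (CommRingCat.ofHom e.toRingHom)
  hom_inv_id := (SpecMap_comp_SpecMap_eq (c := RingHom.id _) e.symm_apply_apply).trans
    (Spec.map_id _)
  inv_hom_id := (SpecMap_comp_SpecMap_eq (c := RingHom.id _) e.apply_symm_apply).trans
    (Spec.map_id _)

/-- The action of `g` on the base change `A₁ ⊗ B`. -/
def tensorAct (A B : Type u) [CommRing A] [CommRing B] [Algebra A B]
    [MulSemiringAction G B] [SMulCommClass G A B] (A₁ : Type u) [CommRing A₁] [Algebra A A₁]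
    (g : G) : A₁ ⊗[A] B →ₐ[A₁] A₁ ⊗[A] B :=
  Algebra.TensorProduct.map (AlgHom.id A₁ A₁) (MulSemiringAction.toAlgHom A B g)

theorem SpecMap_tensorAct_comp {j : Spec (.of B) ⟶ X} {g : G}
    (hj : Spec.map (CommRingCat.ofHom (MulSemiringAction.toRingHom G B g)) ≫ j = j ≫ act ρ g)
    (A₁ : Type u) [CommRing A₁] [Algebra A A₁] :
    Spec.map (CommRingCat.ofHom (tensorAct A B A₁ g).toRingHom) ≫
      Spec.map (CommRingCat.ofHom
        (Algebra.TensorProduct.includeRight : B →ₐ[A] A₁ ⊗[A] B).toRingHom) ≫ j =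
    (Spec.map (CommRingCat.ofHom
        (Algebra.TensorProduct.includeRight : B →ₐ[A] A₁ ⊗[A] B).toRingHom) ≫ j) ≫ act ρ g := by
  have e := SpecMap_comp_SpecMap
    (a := (Algebra.TensorProduct.includeRight : B →ₐ[A] A₁ ⊗[A] B).toRingHom)
    (b := (tensorAct A B A₁ g).toRingHom) (c := MulSemiringAction.toRingHom G B g)
    (d := (Algebra.TensorProduct.includeRight : B →ₐ[A] A₁ ⊗[A] B).toRingHom) fun b => rfl
  rw [Category.assoc, ← hj, ← Category.assoc, e, Category.assoc]

/-- An equivariant isomorphism of algebras after a base change gives an equivariant isomorphism of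
covers. -/
theorem isoOver_of_algEquiv {i : Spec (.of A) ⟶ Y} {j : Spec (.of B) ⟶ X} {j' : Spec (.of B') ⟶ X'}
    (h : IsPullback j (Spec.map (CommRingCat.ofHom (algebraMap A B))) π i)
    (h' : IsPullback j' (Spec.map (CommRingCat.ofHom (algebraMap A B'))) π' i)
    (hj : ∀ g : G, Spec.map (CommRingCat.ofHom (MulSemiringAction.toRingHom G B g)) ≫ j =
      j ≫ act ρ g)
    (hj' : ∀ g : G, Spec.map (CommRingCat.ofHom (MulSemiringAction.toRingHom G B' g)) ≫ j' =
      j' ≫ act ρ' g)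
    (A₁ : Type u) [CommRing A₁] [Algebra A A₁] (Θ : A₁ ⊗[A] B ≃ₐ[A₁] A₁ ⊗[A] B')
    (hΘ : ∀ (g : G) b, Θ (1 ⊗ₜ (g • b)) = Algebra.TensorProduct.map (AlgHom.id A A₁)
      (MulSemiringAction.toAlgHom A B' g) (Θ (1 ⊗ₜ b))) :
    IsoOver ρ ρ' (Spec.map (CommRingCat.ofHom (algebraMap A A₁)) ≫ i) := by
  have hγ (g : G) : (Θ : _ →ₐ[A₁] _).comp (tensorAct A B A₁ g) =
      (tensorAct A B' A₁ g).comp Θ := by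
    apply Algebra.TensorProduct.ext_ring
    ext b
    exact hΘ g b
  have hγ' (g : G) (t) : tensorAct A B A₁ g (Θ.symm t) = Θ.symm (tensorAct A B' A₁ g t) := by
    apply Θ.injective
    have := DFunLike.congr_fun (hγ g) (Θ.symm t)
    simpa using this
  exact isoOver_of_isPullback (isPullback_tensorProduct h A₁) (isPullback_tensorProduct h' A₁)
    (specIso Θ.toRingEquiv) (SpecMap_comp_SpecMap_eq fun a => Θ.symm.commutes a) fun g =>
    ⟨Spec.map (CommRingCat.ofHom (tensorAct A B A₁ g).toRingHom),
      Spec.map (CommRingCat.ofHom (tensorAct A B' A₁ g).toRingHom),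
      SpecMap_comp_SpecMap_eq fun a => (tensorAct A B A₁ g).commutes a,
      SpecMap_tensorAct_comp (hj g) A₁,
      SpecMap_comp_SpecMap_eq fun a => (tensorAct A B' A₁ g).commutes a,
      SpecMap_tensorAct_comp (hj' g) A₁, SpecMap_comp_SpecMap (hγ' g)⟩

end Affine

section Charts

variable {k : Type u} [Field k] (q : Y ⟶ Spec (.of k)) {V : Y.Opens}

/-- The inclusion of an affine open set of `Y`, as a morphism from a spectrum. -/
def baseChart (hV : IsAffineOpen V) : Spec (.of (BaseSections q V)) ⟶ Y := hV.fromSpec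

/-- The inclusion of the preimage of an affine open set of `Y`, as a morphism from a spectrum. -/
def coverChart (ρ : G →* Aut (Over.mk π)) (hW : IsAffineOpen (π ⁻¹ᵁ V)) :
    Spec (.of (CoverSections q ρ V)) ⟶ X := hW.fromSpec

theorem isPullback_chart (ρ : G →* Aut (Over.mk π)) (hV : IsAffineOpen V)
    (hW : IsAffineOpen (π ⁻¹ᵁ V)) :
    IsPullback (coverChart q ρ hW)
      (Spec.map (CommRingCat.ofHom (algebraMap (BaseSections q V) (CoverSections q ρ V)))) π
      (baseChart q hV) := (isPullback_fromSpec π hV hW).flip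

theorem SpecMap_comp_apply {A A₁ : Type u} [CommRing A] [CommRing A₁] [Algebra A A₁]
    (i : Spec (.of A) ⟶ Y) (x : PrimeSpectrum A₁) :
    (Spec.map (CommRingCat.ofHom (algebraMap A A₁)) ≫ i) x =
      i (PrimeSpectrum.comap (algebraMap A A₁) x) := rfl

theorem SpecMap_comp_baseChart_apply (hV : IsAffineOpen V) {A₁ : Type u} [CommRing A₁]
    [Algebra (BaseSections q V) A₁] {y : Y} (hy : y ∈ V) {x : PrimeSpectrum A₁}
    (hx : PrimeSpectrum.comap (algebraMap (BaseSections q V) A₁) x = hV.primeIdealOf ⟨y, hy⟩) :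
    (Spec.map (CommRingCat.ofHom (algebraMap (BaseSections q V) A₁)) ≫ baseChart q hV) x = y := by
  rw [SpecMap_comp_apply, hx]
  exact hV.fromSpec_primeIdealOf ⟨y, hy⟩

theorem SpecMap_smul_comp_coverChart (ρ : G →* Aut (Over.mk π)) (hW : IsAffineOpen (π ⁻¹ᵁ V))
    (g : G) :
    Spec.map (CommRingCat.ofHom (MulSemiringAction.toRingHom G (CoverSections q ρ V) g)) ≫
      coverChart q ρ hW = coverChart q ρ hW ≫ act ρ g :=
  IsAffineOpen.SpecMap_appLE_fromSpec (act ρ g) hW hW (preimage_le ρ g V)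

end Charts

end Descent

end

end AbelianCover

theorem proposition3p2 {k : Type u} [Field k] [IsAlgClosed k]
    {G : Type v} [CommGroup G] [Finite G] (hG : (Nat.card G : k) ≠ 0)
    {X X' Y : Scheme.{u}} (q : Y ⟶ Spec (.of k))
    (hY : AbelianCover.IsVariety q) (hYsmooth : Smooth q)
    (π : X ⟶ Y) (ρ : G →* Aut (Over.mk π))
    (hX : AbelianCover.IsVariety (π ≫ q)) (hXnormal : AbelianCover.IsNormalScheme X)
    (hπ : AbelianCover.IsGCover ρ)
    (π' : X' ⟶ Y) (ρ' : G →* Aut (Over.mk π'))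
    (hX' : AbelianCover.IsVariety (π' ≫ q)) (hX'normal : AbelianCover.IsNormalScheme X')
    (hπ' : AbelianCover.IsGCover ρ')
    (hdata : AbelianCover.SameBuildingData q ρ ρ') (y : Y) :
    ∃ (U : Scheme.{u}) (f : U ⟶ Y) (x : U), Etale f ∧ f x = y ∧
      AbelianCover.IsoOver ρ ρ' f := by
  open AbelianCover in
  obtain ⟨V, hV, hy, -⟩ := exists_isAffineOpen_mem_and_subset (x := y) (U := ⊤) trivial
  have hW := hπ.isAffineOpen_preimage hV
  have hW' := hπ'.isAffineOpen_preimage hV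
  have := isDomain_baseSections (q := q) hY hy
  have := isDomain_coverSections (q := q) hX hπ hy
  have := isDomain_coverSections (q := q) hX' hπ' hy
  have : IsDomain Γ(X, π ⁻¹ᵁ V) := ‹IsDomain (CoverSections q ρ V)›
  have : IsDomain Γ(X', π' ⁻¹ᵁ V) := ‹IsDomain (CoverSections q ρ' V)›
  have := faithfulSMul_sections (q := q) (V := V) hπ
  have := faithfulSMul_sections (q := q) (V := V) hπ'
  have := isInvariant_sections (q := q) (V := V) hπ
  have := isInvariant_sections (q := q) (V := V) hπ'
  have : IsNoetherianRing (BaseSections q V) := isNoetherianRing_sections hY hV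
  have : IsNoetherianRing (CoverSections q ρ V) := isNoetherianRing_sections hX hW
  have : IsNoetherianRing (CoverSections q ρ' V) := isNoetherianRing_sections hX' hW'
  have : IsIntegrallyClosed (CoverSections q ρ V) := isIntegrallyClosed_sections hXnormal hW
  have : IsIntegrallyClosed (CoverSections q ρ' V) := isIntegrallyClosed_sections hX'normal hW'
  have : IsIntegrallyClosed (BaseSections q V) :=
    isIntegrallyClosed_of_isInvariant _ (CoverSections q ρ V) G
  obtain ⟨A₁, _, _, hA₁, hsurj, Θ, hΘ⟩ := exists_etale_algEquiv hG
    (eq_one_of_forall_smul_eq (q := q) hX hπ hV hy)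
    (eq_one_of_forall_smul_eq (q := q) hX' hπ' hV hy)
    (fun p _ hp => exists_hasInertiaAt_of_branchDivisor_eq hG hX hXnormal hπ hX' hX'normal hπ'
      hdata.branch hV p hp)
    (fun η => (hdata.line η).some.linearEquiv V)
  obtain ⟨x, hx⟩ := hsurj (hV.primeIdealOf ⟨y, hy⟩)
  refine ⟨Spec (.of A₁),
    Spec.map (CommRingCat.ofHom (algebraMap (BaseSections q V) A₁)) ≫ baseChart q hV, x, ?_, ?_,
    isoOver_of_algEquiv (isPullback_chart q ρ hV hW) (isPullback_chart q ρ' hV hW')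
      (SpecMap_smul_comp_coverChart q ρ hW) (SpecMap_smul_comp_coverChart q ρ' hW') A₁ Θ hΘ⟩
  · have : Etale (Spec.map (CommRingCat.ofHom (algebraMap (BaseSections q V) A₁))) :=
      HasRingHomProperty.Spec_iff.mpr (RingHom.etale_algebraMap.mpr hA₁)
    have : IsOpenImmersion (baseChart q hV) := inferInstanceAs (IsOpenImmersion hV.fromSpec)
    infer_instance
  · exact SpecMap_comp_baseChart_apply q hV hy hx
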